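/- All matroids have a finite ground set. An integer matrix $A$ is $\Delta$-modular if every $\operatorname{rank}(A)\times\operatorname{rank}(A)$ submatrix of $A$ has determinant of absolute value at most $\Delta$. A matroid is $\Delta$-modular if it is represented over $\mathbb{R}$ by a $\Delta$-modular integer matrix. Two elements are parallel if they form a circuit of size $2$; a matroid is simple if it has no loops and no parallel elements. $M(K_{r+1})$ denotes the graphic matroid of the complete graph on $r+1$ vertices. A frame for a matroid $N\cong M(K_{r+1})$ is a basis $B$ of $N$ such that each element of $N$ is spanned by a subset of $B$ of size at most two. **Proposition 3.1.** Let $r$ and $\Delta$ be positive integers, and let $M$ be a simple rank-$r$ $\Delta$-modular matroid with a set $X \subseteq E(M)$ such that $M|X \cong M(K_{r+1})$. Let $B \subseteq X$ be a frame for $M|X$. Then 1. there is a set $B' \subseteq B$ of size at most $10\Delta^2\lfloor\log_2\Delta\rfloor$ such that each element of $E(M) - X$ that is a non-loop of $M/B'$ is parallel in $M/B'$ to an element of $B - B'$; and 2. $|E(M)| \le \binom{r+1}{2} + 66\Delta^7\cdot r$. -/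

import Mathlib

/-! ### The cycle matroid of a finite simple graph -/

/-- The augmentation property of forests, for edge sets of simple graphs on a finite vertex set. -/
theorem SimpleGraph.exists_isAcyclic_insert_of_ncard_lt {V : Type*} [Finite V]
    (G : SimpleGraph V) {I J : Set (Sym2 V)}
    (hI : I ⊆ G.edgeSet ∧ (SimpleGraph.fromEdgeSet I).IsAcyclic)
    (hJ : J ⊆ G.edgeSet ∧ (SimpleGraph.fromEdgeSet J).IsAcyclic)
    (hIJ : I.ncard < J.ncard) :
    ∃ e ∈ J, e ∉ I ∧
      (insert e I ⊆ G.edgeSet ∧ (SimpleGraph.fromEdgeSet (insert e I)).IsAcyclic) := by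
  classical
  by_contra! hcon
  have hne : J.Nonempty := by
    rw [← Set.ncard_pos (Set.toFinite J)]
    omega
  have hVne : Nonempty V := by
    obtain ⟨e, -⟩ := hne
    induction e using Sym2.ind with
    | _ x y => exact ⟨x⟩
  have hreach : ∀ x y, s(x, y) ∈ J → (SimpleGraph.fromEdgeSet I).Reachable x y := by
    intro x y hxy
    by_cases hmem : s(x, y) ∈ I
    · have hadj : G.Adj x y := hJ.1 hxy
      refine SimpleGraph.Adj.reachable ?_
      rw [SimpleGraph.fromEdgeSet_adj]
      exact ⟨hmem, hadj.ne⟩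
    · by_contra hr
      refine hcon _ hxy hmem (Set.insert_subset (hJ.1 hxy) hI.1) ?_
      have h2 := (SimpleGraph.isAcyclic_add_edge_iff_of_not_reachable x y hr).2 hI.2
      rw [SimpleGraph.edge, ← SimpleGraph.fromEdgeSet_union] at h2
      rwa [Set.insert_eq, Set.union_comm]
  obtain ⟨T, hJT, -, hT⟩ := (SimpleGraph.connected_top (V := V)).exists_isTree_le_of_le_of_isAcyclic
    (le_top (a := SimpleGraph.fromEdgeSet J)) hJ.2
  have hJsub : J ⊆ T.edgeSet := by
    intro e he
    induction e using Sym2.ind with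
    | _ x y =>
      refine hJT ?_
      rw [SimpleGraph.fromEdgeSet_adj]
      exact ⟨he, (show G.Adj x y from hJ.1 he).ne⟩
  have hTcard : Nat.card T.edgeSet + 1 = Nat.card V :=
    (SimpleGraph.isTree_iff_connected_and_card.1 hT).2
  set K : Set (Sym2 V) := T.edgeSet \ J with hK
  have hconn : (SimpleGraph.fromEdgeSet (I ∪ K)).Connected := by
    have hmono : SimpleGraph.fromEdgeSet I ≤ SimpleGraph.fromEdgeSet (I ∪ K) :=
      SimpleGraph.fromEdgeSet_mono Set.subset_union_left
    have key : ∀ x y, T.Reachable x y → (SimpleGraph.fromEdgeSet (I ∪ K)).Reachable x y := by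
      rintro x y ⟨w⟩
      induction w with
      | nil => exact SimpleGraph.Reachable.refl _
      | @cons a b c hab _ ih =>
        refine SimpleGraph.Reachable.trans ?_ ih
        by_cases hm : s(a, b) ∈ J
        · exact (hreach _ _ hm).mono hmono
        · refine SimpleGraph.Adj.reachable ?_
          rw [SimpleGraph.fromEdgeSet_adj]
          exact ⟨Or.inr ⟨hab, hm⟩, hab.ne⟩
    exact ⟨fun x y => key x y (hT.connected.preconnected x y)⟩
  have h1 := hconn.card_vert_le_card_edgeSet_add_one
  have h2 : Nat.card (SimpleGraph.fromEdgeSet (I ∪ K)).edgeSet ≤ I.ncard + K.ncard := by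
    rw [Nat.card_coe_set_eq]
    refine le_trans (Set.ncard_le_ncard ?_ (Set.toFinite _)) (Set.ncard_union_le I K)
    rw [SimpleGraph.edgeSet_fromEdgeSet]
    exact Set.sdiff_subset
  have h3 : K.ncard + J.ncard = T.edgeSet.ncard :=
    Set.ncard_sdiff_add_ncard_of_subset hJsub (Set.toFinite _)
  rw [Nat.card_coe_set_eq] at hTcard
  omega

/-- The cycle (graphic) matroid `M(G)` of a simple graph `G` on a finite vertex set: the ground set
is the set of edges of `G`, and a set of edges is independent iff it is the edge set of a forest. -/
def SimpleGraph.cycleMatroid {V : Type*} [Finite V] (G : SimpleGraph V) : Matroid (Sym2 V) :=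
  (IndepMatroid.ofFinite (E := G.edgeSet) (Set.toFinite _)
    (fun I => I ⊆ G.edgeSet ∧ (SimpleGraph.fromEdgeSet I).IsAcyclic)
    ⟨Set.empty_subset _, by
      rw [SimpleGraph.fromEdgeSet_empty]
      exact SimpleGraph.isAcyclic_bot⟩
    (fun _ _ hJ hIJ =>
      ⟨hIJ.trans hJ.1, hJ.2.anti (SimpleGraph.fromEdgeSet_mono hIJ)⟩)
    (fun _ _ hI hJ hIJ => SimpleGraph.exists_isAcyclic_insert_of_ncard_lt G hI hJ hIJ)
    (fun _ hI => hI.1)).matroid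

@[simp] theorem SimpleGraph.cycleMatroid_ground {V : Type*} [Finite V] (G : SimpleGraph V) :
    G.cycleMatroid.E = G.edgeSet := rfl

@[simp] theorem SimpleGraph.cycleMatroid_indep_iff {V : Type*} [Finite V] (G : SimpleGraph V)
    (I : Set (Sym2 V)) :
    G.cycleMatroid.Indep I ↔ I ⊆ G.edgeSet ∧ (SimpleGraph.fromEdgeSet I).IsAcyclic :=
  Iff.rfl

/-! ### Matroid notions -/

namespace Matroid

/-- Two matroids are isomorphic if some bijection between their ground sets preserves and reflects
independence. -/
def IsIsomorphic {α β : Type*} (M : Matroid α) (N : Matroid β) : Prop :=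
  ∃ φ : α → β, Set.BijOn φ M.E N.E ∧ ∀ I ⊆ M.E, (M.Indep I ↔ N.Indep (φ '' I))

/-- Two elements are parallel if they are the two elements of a circuit of size two. -/
def IsParallel {α : Type*} (M : Matroid α) (e f : α) : Prop :=
  e ≠ f ∧ M.IsCircuit {e, f}

/-- A matroid is simple if it has no loops and no parallel elements. -/
def IsSimple {α : Type*} (M : Matroid α) : Prop :=
  (∀ e, ¬ M.IsLoop e) ∧ ∀ e f, ¬ M.IsParallel e f

/-- A frame of `N` is a basis `B` of `N` such that each element of `N` is spanned by a subset of
`B` of size at most two. -/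
def IsFrame {α : Type*} (N : Matroid α) (B : Set α) : Prop :=
  N.IsBase B ∧ ∀ e ∈ N.E, ∃ S ⊆ B, S.encard ≤ 2 ∧ e ∈ N.closure S

end Matroid

/-- An integer matrix `A` is `Δ`-modular if each `rank A × rank A` submatrix of `A` has determinant
of absolute value at most `Δ`. -/
def Matrix.IsDeltaModular {m n : ℕ} (A : Matrix (Fin m) (Fin n) ℤ) (Δ : ℕ) : Prop :=
  ∀ (f : Fin (A.map (Int.cast : ℤ → ℝ)).rank ↪ Fin m)
    (g : Fin (A.map (Int.cast : ℤ → ℝ)).rank ↪ Fin n),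
    |(A.submatrix f g).det| ≤ (Δ : ℤ)

/-- A matroid is `Δ`-modular if it is represented over `ℝ` by a `Δ`-modular integer matrix: the
columns are indexed by the (finite) ground set, through the bijection `c`, and a set of elements is
independent iff the corresponding columns are linearly independent over `ℝ`. -/
def Matroid.IsDeltaModular {α : Type*} (M : Matroid α) (Δ : ℕ) : Prop :=
  ∃ (m n : ℕ) (A : Matrix (Fin m) (Fin n) ℤ) (c : Fin n ≃ M.E),
    A.IsDeltaModular Δ ∧
      ∀ S : Set (Fin n), M.Indep ((fun j => (c j : α)) '' S) ↔
        LinearIndepOn ℝ (A.map (Int.cast : ℤ → ℝ)).col S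

/-!
The matroid is represented by integer vectors with `r` coordinates whose determinants are at most
`Δ` (`Matroid.IsDeltaModular.exists_int_vectors`). A count of the edges shows that a frame of
`M(K_{r+1})` consists of the edges at one vertex (`Matroid.IsFrame.exists_star`). In coordinates with
respect to suitable multiples of the frame elements, the elements of `X` are therefore multiples of
unit vectors and of differences of two unit vectors, and a determinant of coordinate vectors is an
integer of absolute value at most `Δ` up to a fixed factor (`FramedConfig`,
`Matroid.IsSimple.exists_framedConfig`).

For the first part, choose elements in the span of some frame elements `C` such that the
determinants that extend them have a common divisor `q` as large as possible, subject to
`|C| ≤ 2 q`. As `q ≤ Δ`, the set `C` is small. At least half of the nonzero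
coordinates of an element outside of `C` have the same sign. Contraction of edges of the complete
graph adds them up, so if there were two of them, they would allow a further choice with a larger
`q`. Hence modulo `C` each element is zero, a frame element or an edge of the complete graph
(`FramedConfig.exists_graphic_mod`). The elements outside of `X` that are edges modulo `C` have
nonzero coordinates in `C`. If many of them were disjoint, then a set `S ⊆ C` of vertices could be
identified such that the coordinate sums over `S` do not vanish for half of them. Joined by edges of
the complete graph to a path, these would give a determinant that is the sum of as many nonzero
integers of the same sign (`FramedConfig.card_le_of_oriented_pairs`). So a maximal matching of such
edges is small, and its vertices together with `C` form the contracted set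
(`FramedConfig.exists_contraction_set`), of size at most `6 * Δ`.

For the second part, each element outside of `X` is in the span of the contracted set and one further
frame element, which leaves `r` subspaces of dimension at most `6 * Δ + 1`. In such a subspace, take
coordinates with respect to elements of maximal determinant, so that all minors are at most one. The
integer vectors form at most `Δ` classes modulo the lattice of these elements. Within a class, a
vector is determined, up to its sign, by the support of the integral coordinates and the signs of the
other ones. These two set families shatter no sets of size three and five respectively, since
certain determinants would exceed one, and the Sauer-Shelah lemma bounds their sizes
(`MinorsLeOne.card_class_le`, `card_le_of_abs_det_le`).
-/

/-! ### Determinants of matrices with a triangular structure -/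

namespace Matrix

variable {ι R : Type*} [Fintype ι] [DecidableEq ι] [CommRing R]

/-- If the off-diagonal entry `A i j` vanishes whenever `key j ≤ key i`, then `A` is triangular up
to a reordering, even if `key` is not injective, and its determinant is the product of the diagonal
entries. -/
theorem det_eq_prod_diag_of_key (A : Matrix ι ι R) (key : ι → ℕ)
    (h : ∀ i j, i ≠ j → key j ≤ key i → A i j = 0) : A.det = ∏ i, A i i := by
  rw [det_apply, Finset.sum_eq_single 1]
  · simp
  · intro σ _ hσ
    suffices hz : ∃ i, A (σ i) i = 0 by
      obtain ⟨i, hi⟩ := hz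
      have h0 : ∏ j, A (σ j) j = 0 := Finset.prod_eq_zero (Finset.mem_univ i) hi
      exact (congrArg _ h0).trans (smul_zero _)
    by_contra! hne
    have hle : ∀ i, key (σ i) ≤ key i := by
      intro i
      by_contra! hlt
      have hi : σ i ≠ i := by
        intro hi
        rw [hi] at hlt
        exact lt_irrefl _ hlt
      exact hne i (h _ _ hi hlt.le)
    have hsum : ∑ i, key (σ i) = ∑ i, key i := Equiv.sum_comp σ key
    have heq := (Finset.sum_eq_sum_iff_of_le fun i _ => hle i).1 hsum
    apply hσ
    ext i
    by_contra hi
    exact hne i (h _ _ hi (heq i (Finset.mem_univ i)).ge)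
  · simp

/-- If the rows with index in `C` are supported on `C`, the determinant is the product of a function
of the rows in `C` and a function of the rows outside of `C`. -/
theorem det_mul_det_piecewise (C : Finset ι) (A A' B B' : ι → ι → R)
    (hA : ∀ i ∈ C, ∀ j ∉ C, A i j = 0) (hA' : ∀ i ∈ C, ∀ j ∉ C, A' i j = 0) :
    (of (C.piecewise A B)).det * (of (C.piecewise A' B')).det =
      (of (C.piecewise A B')).det * (of (C.piecewise A' B)).det := by
  have key : ∀ A B : ι → ι → R, (∀ i ∈ C, ∀ j ∉ C, A i j = 0) →
      (of (C.piecewise A B)).det =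
        (toSquareBlockProp (of B) (fun i => i ∉ C)).det *
          (toSquareBlockProp (of A) (fun i => ¬ i ∉ C)).det := by
    intro A B hA
    rw [twoBlockTriangular_det _ (fun i => i ∉ C)]
    · congr 2
      · ext i j
        simp [toSquareBlockProp, Finset.piecewise, i.2]
      · ext i j
        have := not_not.1 i.2
        simp [toSquareBlockProp, Finset.piecewise, this]
    · intro i hi j hj
      rw [not_not] at hi
      simp [Finset.piecewise, hi, hA i hi j hj]
  rw [key A B hA, key A' B' hA', key A B' hA, key A' B hA']
  ring

/-- The determinant of a matrix whose rows in `C` are supported on `C` and whose other rows are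
multiples of unit vectors, with the exception of the row `i₀`. -/
theorem det_of_single_rows (C : Finset ι) (A : ι → ι → R) (i₀ : ι)
    (hA : ∀ i ∈ C, ∀ j ∉ C, A i j = 0)
    (hs : ∀ i ∉ C, i ≠ i₀ → ∀ j, j ≠ i → A i j = 0) :
    (of A).det = (∏ i ∈ Cᶜ, A i i) *
      (toSquareBlockProp (of A) (fun i => ¬ i ∉ C)).det := by
  rw [twoBlockTriangular_det _ (fun i => i ∉ C)]
  · congr 1
    rw [det_eq_prod_diag_of_key _ (fun i => if i.1 = i₀ then 0 else 1)]
    · exact (Finset.prod_subtype Cᶜ (p := fun i => i ∉ C) (by simp) fun i => A i i).symm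
    · intro i j hij hk
      have hi : i.1 ≠ i₀ := by
        intro hi
        have hj : j.1 ≠ i₀ := fun hj => hij (Subtype.ext (hi.trans hj.symm))
        simp [hi, hj] at hk
      exact hs i.1 i.2 hi j.1 fun h => hij (Subtype.ext h.symm)
  · intro i hi j hj
    rw [not_not] at hi
    exact hA i hi j hj

/-- Replacing column `i₀` by the sum of the columns in `P ∋ i₀` does not change the determinant. -/
theorem det_sum_col (P : Finset ι) (i₀ : ι) (hi₀ : i₀ ∈ P) (A : ι → ι → R) :
    (of fun i => Function.update (A i) i₀ (∑ k ∈ P, A i k)).det = (of A).det := by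
  have h := det_updateCol_sum (of A) i₀ (fun k => if k ∈ P then 1 else 0)
  simp only [hi₀, if_true, one_smul] at h
  rw [← h]
  congr 1
  ext i j
  simp [updateCol_apply, Function.update_apply, Finset.sum_ite_mem]

end Matrix

/-! ### Framed configurations and contraction states -/

/-- A finite system of vectors in coordinates adapted to a frame of `M(K_{n+1})`, where `n` is the
size of `ι`. An element `e ∈ E` has the coordinate vector `x e`. The frame elements `b i` and the
elements `k i j` joining them represent `M(K_{n+1})`: they are nonzero multiples of the unit vectors
and of the differences of two unit vectors. The constant `d` turns the determinants of the
coordinate vectors into the determinants of an integer matrix, which are at most `Δ`. -/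
structure FramedConfig (ι α : Type*) [Fintype ι] [DecidableEq ι] (Δ : ℕ) where
  E : Set α
  x : α → ι → ℝ
  d : ℝ
  d_ne : d ≠ 0
  exists_int : ∀ h : ι → α, (∀ i, h i ∈ E) →
    ∃ z : ℤ, |z| ≤ Δ ∧ d * (Matrix.of fun i => x (h i)).det = z
  b : ι → α
  b_mem : ∀ i, b i ∈ E
  β : ι → ℝ
  β_ne : ∀ i, β i ≠ 0
  x_b : ∀ i, x (b i) = Pi.single i (β i)
  k : ι → ι → α
  k_mem : ∀ i j, i ≠ j → k i j ∈ E
  a : ι → ι → ℝ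
  a_ne : ∀ i j, i ≠ j → a i j ≠ 0
  x_k : ∀ i j, i ≠ j → x (k i j) = Pi.single i (a i j) - Pi.single j (a i j)

namespace FramedConfig

variable {ι α : Type*} [Fintype ι] [DecidableEq ι] {Δ : ℕ} (F : FramedConfig ι α Δ)

/-- The integral determinant of the elements `h i`. -/
noncomputable def D (h : ι → α) : ℝ := F.d * (Matrix.of fun i => F.x (h i)).det

theorem D_b : F.D F.b = F.d * ∏ i, F.β i := by
  rw [D, Matrix.det_eq_prod_diag_of_key _ (fun _ => 0)]
  · simp [F.x_b]
  · intro i j hij _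
    simp [F.x_b, Ne.symm hij]

theorem D_b_ne : F.D F.b ≠ 0 := by
  rw [D_b]
  exact mul_ne_zero F.d_ne (Finset.prod_ne_zero_iff.2 fun i _ => F.β_ne i)

/-- A state consists of elements `g i`, for `i ∈ C`, in the span of the frame elements in `C`, such
that `q` divides each determinant that extends them. The contraction of `C` then divides the
determinants by `q`. -/
structure IsState (C : Finset ι) (g : ι → α) (q : ℕ) : Prop where
  mem : ∀ i, g i ∈ F.E
  supp : ∀ i ∈ C, ∀ k ∉ C, F.x (g i) k = 0
  dvd : ∀ h : ι → α, (∀ i, h i ∈ F.E) → ∃ z : ℤ, F.D (C.piecewise g h) = q * z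
  ne_zero : F.D (C.piecewise g F.b) ≠ 0

variable {F}

theorem isState_empty : F.IsState ∅ F.b 1 where
  mem := F.b_mem
  supp := by simp
  dvd h hh := by
    obtain ⟨z, -, hz⟩ := F.exists_int h hh
    exact ⟨z, by simpa [D] using hz⟩
  ne_zero := by simpa using F.D_b_ne

theorem piecewise_mem {C : Finset ι} {g h : ι → α} (hg : ∀ i, g i ∈ F.E)
    (hh : ∀ i, h i ∈ F.E) (i : ι) : C.piecewise g h i ∈ F.E := by
  by_cases hi : i ∈ C <;> simp [hi, hg, hh]

theorem IsState.q_ne_zero {C : Finset ι} {g : ι → α} {q : ℕ} (hs : F.IsState C g q) : q ≠ 0 := by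
  rintro rfl
  obtain ⟨z, hz⟩ := hs.dvd F.b F.b_mem
  exact hs.ne_zero (by simpa using hz)

theorem IsState.q_le {C : Finset ι} {g : ι → α} {q : ℕ} (hs : F.IsState C g q) : q ≤ Δ := by
  obtain ⟨z, hz⟩ := hs.dvd F.b F.b_mem
  obtain ⟨z', hz', he⟩ := F.exists_int _ (piecewise_mem (C := C) hs.mem F.b_mem)
  have h1 : z' = q * z := by
    have : (z' : ℝ) = ((q * z : ℤ) : ℝ) := by
      rw [← he]
      push_cast
      exact hz
    exact_mod_cast this
  have hne : z' ≠ 0 := by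
    rintro rfl
    exact hs.ne_zero (by simpa [D] using he)
  have h2 : (q : ℤ) ≤ |z'| := Int.le_of_dvd (abs_pos.2 hne) ((dvd_abs _ _).2 ⟨z, h1⟩)
  exact_mod_cast h2.trans hz'

/-- The determinants of two completions of the elements in the first part `C` are proportional. -/
theorem D_mul_D (C : Finset ι) (g g' h h' : ι → α)
    (hg : ∀ i ∈ C, ∀ k ∉ C, F.x (g i) k = 0) (hg' : ∀ i ∈ C, ∀ k ∉ C, F.x (g' i) k = 0) :
    F.D (C.piecewise g h) * F.D (C.piecewise g' h') =
      F.D (C.piecewise g h') * F.D (C.piecewise g' h) := by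
  have key : ∀ g h : ι → α, F.D (C.piecewise g h) =
      F.d * (Matrix.of (C.piecewise (fun i => F.x (g i)) (fun i => F.x (h i)))).det := by
    intro g h
    rw [D]
    congr 3
    ext i j
    by_cases hi : i ∈ C <;> simp [hi]
  have := Matrix.det_mul_det_piecewise C (fun i => F.x (g i)) (fun i => F.x (g' i))
    (fun i => F.x (h i)) (fun i => F.x (h' i)) hg hg'
  rw [key, key, key, key]
  linear_combination F.d ^ 2 * this

theorem _root_.Finset.piecewise_union_left {ι α : Type*} [DecidableEq ι] (C S : Finset ι)
    (g h₁ h : ι → α) :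
    (C ∪ S).piecewise (C.piecewise g h₁) h = C.piecewise g (S.piecewise h₁ h) := by
  ext i
  by_cases hC : i ∈ C <;> by_cases hS : i ∈ S <;> simp [hC, hS]

/-- A state extends by each admissible choice `h₁` of elements at the positions in `S`. The
determinants of the choices, after division by their greatest common divisor `q * n`, are the
integers `z` by which `q` grows. -/
theorem IsState.exists_extend {C : Finset ι} {g : ι → α} {q : ℕ} (hs : F.IsState C g q)
    (S : Finset ι) :
    ∃ n : ℤ, n ≠ 0 ∧ ∀ h₁ : ι → α, (∀ i, h₁ i ∈ F.E) →
      (∀ i ∈ S, ∀ k ∉ C ∪ S, F.x (h₁ i) k = 0) →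
      ∃ z : ℤ, F.D ((C ∪ S).piecewise (C.piecewise g h₁) F.b) = q * (n * z) ∧
        (z ≠ 0 → F.IsState (C ∪ S) (C.piecewise g h₁) (q * z.natAbs)) := by
  have hq : (q : ℝ) ≠ 0 := Nat.cast_ne_zero.2 hs.q_ne_zero
  have hdvd := hs.dvd
  choose! m hm using hdvd
  set 𝒥 : Set (ι → α) := {h₁ | (∀ i, h₁ i ∈ F.E) ∧ ∀ i ∈ S, ∀ k ∉ C ∪ S, F.x (h₁ i) k = 0}
  have hb𝒥 : F.b ∈ 𝒥 := by
    refine ⟨F.b_mem, fun i hi k hk => ?_⟩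
    have : k ≠ i := by
      rintro rfl
      exact hk (Finset.mem_union_right _ hi)
    simp [F.x_b, this]
  have hsupp : ∀ h₁ ∈ 𝒥, ∀ i ∈ C ∪ S, ∀ k ∉ C ∪ S, F.x (C.piecewise g h₁ i) k = 0 := by
    intro h₁ hh₁ i hi k hk
    by_cases hC : i ∈ C
    · simpa [hC] using hs.supp i hC k fun h => hk (Finset.mem_union_left _ h)
    · have hS : i ∈ S := (Finset.mem_union.1 hi).resolve_left hC
      simpa [hC] using hh₁.2 i hS k hk
  -- `M h₁ h` is the determinant, divided by `q`, of `g` on `C`, `h₁` on `S` and `h` elsewhere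
  set M : (ι → α) → (ι → α) → ℤ := fun h₁ h => m (S.piecewise h₁ h) with hM
  have hDM : ∀ h₁ ∈ 𝒥, ∀ h : ι → α, (∀ i, h i ∈ F.E) →
      F.D ((C ∪ S).piecewise (C.piecewise g h₁) h) = q * M h₁ h := by
    intro h₁ hh₁ h hh
    rw [Finset.piecewise_union_left]
    exact hm _ (piecewise_mem hh₁.1 hh)
  have hprop : ∀ h₁ ∈ 𝒥, ∀ h : ι → α, (∀ i, h i ∈ F.E) →
      M h₁ h * M F.b F.b = M h₁ F.b * M F.b h := by
    intro h₁ hh₁ h hh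
    have := D_mul_D (F := F) (C ∪ S) (C.piecewise g h₁) (C.piecewise g F.b) h F.b
      (hsupp h₁ hh₁) (hsupp _ hb𝒥)
    rw [hDM h₁ hh₁ h hh, hDM _ hb𝒥 _ F.b_mem, hDM _ hh₁ _ F.b_mem, hDM _ hb𝒥 _ hh] at this
    have h2 : (M h₁ h * M F.b F.b : ℝ) = M h₁ F.b * M F.b h := by
      apply mul_left_cancel₀ (mul_ne_zero hq hq)
      linear_combination this
    exact_mod_cast h2
  have hMb : M F.b F.b ≠ 0 := by
    intro h0
    apply hs.ne_zero
    have : S.piecewise F.b F.b = F.b := by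
      ext i
      by_cases hi : i ∈ S <;> simp [hi]
    rw [hm _ F.b_mem, ← this]
    change (q : ℝ) * (M F.b F.b : ℤ) = 0
    simp [h0]
  obtain ⟨n, hn⟩ := (IsPrincipalIdealRing.principal
    (Ideal.span ((fun h₁ => M h₁ F.b) '' 𝒥))).principal
  have hdiv : ∀ h₁ ∈ 𝒥, n ∣ M h₁ F.b := by
    intro h₁ hh₁
    have : M h₁ F.b ∈ Ideal.span ((fun h₁ => M h₁ F.b) '' 𝒥) := Ideal.subset_span ⟨h₁, hh₁, rfl⟩
    rw [hn] at this
    exact Ideal.mem_span_singleton.1 this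
  have hn0 : n ≠ 0 := by
    rintro rfl
    exact hMb (zero_dvd_iff.1 (hdiv _ hb𝒥))
  refine ⟨n, hn0, fun h₁ hE h₁s => ?_⟩
  have hh₁ : h₁ ∈ 𝒥 := ⟨hE, h₁s⟩
  obtain ⟨z, hz⟩ := hdiv h₁ hh₁
  have hD : F.D ((C ∪ S).piecewise (C.piecewise g h₁) F.b) = q * (n * z) := by
    rw [hDM h₁ hh₁ _ F.b_mem, hz]
    push_cast
    ring
  refine ⟨z, hD, fun hz0 => ⟨piecewise_mem hs.mem hE, hsupp h₁ hh₁, fun h hh => ?_, ?_⟩⟩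
  · -- the integers `c` such that `M b b ∣ c * M b h` form an ideal, which hence contains `n`
    have hle : Ideal.span ((fun h₁ => M h₁ F.b) '' 𝒥) ≤
        Submodule.comap (LinearMap.mulRight ℤ (M F.b h)) (Ideal.span {M F.b F.b}) := by
      rw [Ideal.span_le]
      rintro _ ⟨h₂, hh₂, rfl⟩
      change M h₂ F.b * M F.b h ∈ Ideal.span {M F.b F.b}
      rw [Ideal.mem_span_singleton]
      exact ⟨M h₂ h, by rw [← hprop h₂ hh₂ h hh]; ring⟩
    have hmem : n ∈ Ideal.span ((fun h₁ => M h₁ F.b) '' 𝒥) := by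
      rw [hn]
      exact Ideal.mem_span_singleton_self n
    have h3 : n * M F.b h ∈ Ideal.span {M F.b F.b} := hle hmem
    obtain ⟨t, ht⟩ := Ideal.mem_span_singleton.1 h3
    have h4 : M h₁ h = z * t := by
      apply mul_right_cancel₀ hMb
      rw [hprop h₁ hh₁ h hh, hz]
      linear_combination z * ht
    refine ⟨z.sign * t, ?_⟩
    rw [hDM h₁ hh₁ h hh, h4]
    have h5 : ((z.sign * (z.natAbs : ℤ) : ℤ) : ℝ) = (z : ℝ) := by rw [Int.sign_mul_natAbs]
    rw [Int.cast_mul, Int.cast_natCast] at h5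
    push_cast [← h5]
    ring
  · rw [hD]
    exact mul_ne_zero hq (mul_ne_zero (Int.cast_ne_zero.2 hn0) (Int.cast_ne_zero.2 hz0))

variable (F) in
/-- A state in which no admissible choice at few positions increases `q`: a choice at `S` with
`z ≥ 2` and `S.card ≤ 2 * z` multiplies `q` by at least two, which keeps the bound `C.card ≤ 2 * q`,
and `q` is at most `Δ`. -/
theorem exists_terminal_state : ∃ C g q, F.IsState C g q ∧ C.card ≤ 2 * q ∧ (q = 1 → C = ∅) ∧
    ∀ S : Finset ι, Disjoint C S → ∃ n : ℤ, n ≠ 0 ∧ ∀ h₁ : ι → α, (∀ i, h₁ i ∈ F.E) →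
      (∀ i ∈ S, ∀ k ∉ C ∪ S, F.x (h₁ i) k = 0) →
      ∃ z : ℤ, F.D ((C ∪ S).piecewise (C.piecewise g h₁) F.b) = q * (n * z) ∧
        (S.card ≤ 2 * z.natAbs → z.natAbs ≤ 1) := by
  classical
  let P : ℕ → Prop := fun q => ∃ C g, F.IsState C g q ∧ C.card ≤ 2 * q ∧ (q = 1 → C = ∅)
  have hP1 : P 1 := ⟨∅, F.b, isState_empty, by simp, fun _ => rfl⟩
  have hle : ∀ q, P q → q ≤ Δ := fun q ⟨_, _, hs, _⟩ => hs.q_le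
  have hspec : P (Nat.findGreatest P Δ) := Nat.findGreatest_spec (hle 1 hP1) hP1
  set q := Nat.findGreatest P Δ with hq
  obtain ⟨C, g, hs, hC, hC1⟩ := hspec
  refine ⟨C, g, q, hs, hC, hC1, fun S hCS => ?_⟩
  obtain ⟨n, hn, hex⟩ := hs.exists_extend S
  refine ⟨n, hn, fun h₁ hE hsupp => ?_⟩
  obtain ⟨z, hz, hst⟩ := hex h₁ hE hsupp
  refine ⟨z, hz, fun hS => ?_⟩
  by_contra! h2
  -- otherwise the extended state has a larger `q`
  have hq0 : 1 ≤ q := Nat.one_le_iff_ne_zero.2 hs.q_ne_zero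
  have hnew : P (q * z.natAbs) := by
    refine ⟨_, _, hst (by omega), ?_, fun h => ?_⟩
    · rw [Finset.card_union_of_disjoint hCS]
      rcases hq0.eq_or_lt with h1 | h1
      · rw [hC1 h1.symm, ← h1]
        simpa using hS
      · nlinarith
    · have := Nat.le_of_dvd one_pos (Dvd.intro_left q h)
      omega
  have h3 := Nat.le_findGreatest (hle _ hnew) hnew
  rw [← hq] at h3
  nlinarith

end FramedConfig

/-! ### The graphic part modulo a small contraction -/

namespace FramedConfig

variable {ι α : Type*} [Fintype ι] [DecidableEq ι] {Δ : ℕ} {F : FramedConfig ι α Δ}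

variable (F) in
/-- The choice of the element `e` at the position `i₀ ∈ P`, of the elements joining `i` and `i₀` at
the other positions `i ∈ P`, and of frame elements elsewhere. The elements other than `e` identify
the vertices in `P`. -/
def star (e : α) (i₀ : ι) (P : Finset ι) (i : ι) : α :=
  if i = i₀ then e else if i ∈ P then F.k i i₀ else F.b i

theorem star_mem {e : α} (he : e ∈ F.E) (i₀ : ι) (P : Finset ι) (i : ι) :
    F.star e i₀ P i ∈ F.E := by
  unfold star
  split_ifs with h1 h2
  · exact he
  · exact F.k_mem _ _ h1
  · exact F.b_mem i

/-- Identification of the vertices in `P` adds up the coordinates of `e` in `P`. -/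
theorem D_star (C : Finset ι) (g : ι → α) (hg : ∀ i ∈ C, ∀ k ∉ C, F.x (g i) k = 0)
    (e : α) (i₀ : ι) (P : Finset ι) (hi₀ : i₀ ∈ P) (hPC : Disjoint C P) :
    F.D (C.piecewise g (F.star e i₀ P)) =
      (F.d * (Matrix.toSquareBlockProp (Matrix.of fun i => F.x (g i)) (fun i => ¬ i ∉ C)).det) *
      ((∑ k ∈ P, F.x e k) * ∏ i ∈ Cᶜ.erase i₀, if i ∈ P then F.a i i₀ else F.β i) := by
  have hi₀C : i₀ ∉ C := fun h => Finset.disjoint_left.1 hPC h hi₀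
  have hPC' : ∀ k ∈ P, k ∉ C := fun k hk h => Finset.disjoint_left.1 hPC h hk
  rw [D, ← Matrix.det_sum_col P i₀ hi₀, Matrix.det_of_single_rows C _ i₀]
  · rw [← Finset.mul_prod_erase Cᶜ _ (Finset.mem_compl.2 hi₀C)]
    have h1 : ∀ i ∈ Cᶜ.erase i₀, Function.update (F.x (C.piecewise g (F.star e i₀ P) i)) i₀
        (∑ k ∈ P, F.x (C.piecewise g (F.star e i₀ P) i) k) i =
          if i ∈ P then F.a i i₀ else F.β i := by
      intro i hi
      rw [Finset.mem_erase, Finset.mem_compl] at hi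
      rw [Function.update_of_ne hi.1]
      by_cases hP : i ∈ P
      · simp [hi.2, star, hi.1, hP, F.x_k]
      · simp [hi.2, star, hi.1, hP, F.x_b]
    rw [Finset.prod_congr rfl h1]
    have h2 : Matrix.toSquareBlockProp (Matrix.of fun i => Function.update
        (F.x (C.piecewise g (F.star e i₀ P) i)) i₀
        (∑ k ∈ P, F.x (C.piecewise g (F.star e i₀ P) i) k)) (fun i => ¬ i ∉ C) =
        Matrix.toSquareBlockProp (Matrix.of fun i => F.x (g i)) (fun i => ¬ i ∉ C) := by
      ext i j
      have hi := not_not.1 i.2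
      have hj : j.1 ≠ i₀ := fun h => hi₀C (h ▸ not_not.1 j.2)
      simp [Matrix.toSquareBlockProp, hj, hi]
    rw [h2]
    simp only [Function.update_self, hi₀C, not_false_eq_true, Finset.piecewise_eq_of_notMem, star,
      if_true]
    ring
  · intro i hi j hj
    by_cases hj0 : j = i₀
    · subst hj0
      simp only [Function.update_self, hi, Finset.piecewise_eq_of_mem]
      exact Finset.sum_eq_zero fun k hk => hg i hi k (hPC' k hk)
    · simpa [hj0, hi] using hg i hi j hj
  · intro i hi hii j hj
    by_cases hj0 : j = i₀
    · subst hj0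
      by_cases hP : i ∈ P
      · simp [hi, star, hii, hP, F.x_k, hi₀]
      · simp [hi, star, hii, hP, F.x_b]
    · by_cases hP : i ∈ P
      · simp [hi, star, hii, hP, F.x_k, hj0, hj]
      · simp [hi, star, hii, hP, F.x_b, hj0, hj]

theorem star_b (i₀ : ι) : F.star (F.b i₀) i₀ {i₀} = F.b := by
  ext i
  unfold star
  split_ifs with h1 h2
  · rw [h1]
  · exact absurd (Finset.mem_singleton.1 h2) h1
  · rfl

variable (F) in
/-- After contraction of a set of at most `2 * Δ` frame elements, each element is a loop or is
parallel, with a uniform scaling, to an element of the graphic part. In a terminal state, the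
determinants of the choices `star e i₀ P` are the partial coordinate sums of `e` outside of `C`, as
multiples of a common divisor `γ`. At least half of the nonzero coordinates have the same sign, and
if there were two of them, their sum would be a multiple of `γ` that contradicts terminality. So
there are at most two nonzero coordinates, of opposite signs, and a comparison with the frame
elements shows that `γ` is the common scale of the graphic part. -/
theorem exists_graphic_mod : ∃ C : Finset ι, C.card ≤ 2 * Δ ∧ (Δ = 1 → C = ∅) ∧ ∃ s : ℝ, 0 < s ∧
    (∀ i ∉ C, |F.β i| = s) ∧ (∀ i ∉ C, ∀ j ∉ C, i ≠ j → |F.a i j| = s) ∧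
    ∀ e ∈ F.E, (∀ i ∉ C, F.x e i = 0) ∨
      (∃ i ∉ C, |F.x e i| = s ∧ ∀ k ∉ C, k ≠ i → F.x e k = 0) ∨
      (∃ i ∉ C, ∃ j ∉ C, i ≠ j ∧ |F.x e i| = s ∧ F.x e j = -F.x e i ∧
        ∀ k ∉ C, k ≠ i → k ≠ j → F.x e k = 0) := by
  obtain ⟨C, g, q, hs, hC, hC1, hmax⟩ := F.exists_terminal_state
  refine ⟨C, hC.trans (Nat.mul_le_mul_left 2 hs.q_le), fun h => hC1 ?_, ?_⟩
  · have h1 := hs.q_le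
    have h2 := hs.q_ne_zero
    omega
  have hq : (0 : ℝ) < q := Nat.cast_pos.2 (Nat.pos_of_ne_zero hs.q_ne_zero)
  obtain ⟨K, hD⟩ : ∃ K : ℝ, ∀ e i₀ (P : Finset ι), i₀ ∈ P → Disjoint C P →
      F.D (C.piecewise g (F.star e i₀ P)) =
        K * ((∑ k ∈ P, F.x e k) * ∏ i ∈ Cᶜ.erase i₀, if i ∈ P then F.a i i₀ else F.β i) :=
    ⟨_, fun e i₀ P hi₀ hPC => D_star C g hs.supp e i₀ P hi₀ hPC⟩
  -- the maximality of the state, for the choices of the form `star`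
  have hstar : ∀ S : Finset ι, Disjoint C S → ∃ n : ℝ, 0 < n ∧ ∀ e ∈ F.E, ∀ i₀ ∈ S,
      ∀ P ⊆ S, i₀ ∈ P → (∀ k ∉ C ∪ S, F.x e k = 0) → ∃ z : ℕ,
      |K| * (|∑ k ∈ P, F.x e k| * ∏ i ∈ Cᶜ.erase i₀, if i ∈ P then |F.a i i₀| else |F.β i|)
        = n * z ∧ (S.card ≤ 2 * z → z ≤ 1) := by
    intro S hCS
    obtain ⟨n, hn, h⟩ := hmax S hCS
    refine ⟨q * |(n : ℝ)|, mul_pos hq (abs_pos.2 (Int.cast_ne_zero.2 hn)), ?_⟩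
    intro e he i₀ hi₀ P hP hi₀P hek
    obtain ⟨z, hz, hz1⟩ := h (F.star e i₀ P) (star_mem he i₀ P) (by
      intro i hi k hk
      have hki : k ≠ i := by
        rintro rfl
        exact hk (Finset.mem_union_right _ hi)
      have hk0 : k ≠ i₀ := by
        rintro rfl
        exact hk (Finset.mem_union_right _ hi₀)
      unfold star
      split_ifs with h1 h2
      · exact hek k hk
      · simp [F.x_k _ _ h1, hki, hk0]
      · simp [F.x_b, hki])
    refine ⟨z.natAbs, ?_, hz1⟩
    have hpw : (C ∪ S).piecewise (C.piecewise g (F.star e i₀ P)) F.b =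
        C.piecewise g (F.star e i₀ P) := by
      ext i
      by_cases hiC : i ∈ C
      · simp [hiC]
      · by_cases hiS : i ∈ S
        · simp [hiC, hiS]
        · have h1 : i ≠ i₀ := fun h => hiS (h ▸ hi₀)
          have h2 : i ∉ P := fun h => hiS (hP h)
          simp [hiC, hiS, star, h1, h2]
    rw [hpw, hD e i₀ P hi₀P (Finset.disjoint_of_subset_right hP hCS)] at hz
    have hz' := congrArg abs hz
    rw [abs_mul, abs_mul, Finset.abs_prod, abs_mul, abs_mul, Nat.abs_cast] at hz'
    rw [← Int.cast_abs (a := z), Int.abs_eq_natAbs, Int.cast_natCast] at hz'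
    rw [mul_assoc (q : ℝ), ← hz']
    congr 2
    exact Finset.prod_congr rfl fun i _ => (apply_ite abs _ _ _).symm
  by_cases hCu : Cᶜ = ∅
  · have hno : ∀ i, i ∈ C := by
      intro i
      by_contra hi
      simpa [hCu] using Finset.mem_compl.2 hi
    exact ⟨1, one_pos, fun i hi => absurd (hno i) hi, fun i hi => absurd (hno i) hi,
      fun e _ => Or.inl fun i hi => absurd (hno i) hi⟩
  obtain ⟨i₁, hi₁⟩ := Finset.nonempty_iff_ne_empty.2 hCu
  rw [Finset.mem_compl] at hi₁
  have hK0 : 0 < |K| := by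
    rw [abs_pos]
    intro h0
    have := hD (F.b i₁) i₁ {i₁} (Finset.mem_singleton_self _) (by simpa using hi₁)
    rw [h0, zero_mul, star_b] at this
    exact hs.ne_zero this
  have hβ : ∀ i, 0 < |F.β i| := fun i => abs_pos.2 (F.β_ne i)
  have hone : ∀ i ∉ C, ∀ j ∉ C, i ≠ j → |F.a i j| = |F.β i| ∧ |F.a i j| = |F.β j| := by
    intro i hi j hj hij
    have ha : 0 < |F.a i j| := abs_pos.2 (F.a_ne i j hij)
    obtain ⟨n, hn, h⟩ := hstar {i, j} (by simp [hi, hj])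
    have hcard : ({i, j} : Finset ι).card = 2 := Finset.card_pair hij
    rw [hcard] at h
    have hval : ∀ e ∈ F.E, ∀ i₀ ∈ ({i, j} : Finset ι), (∀ k ∉ C ∪ {i, j}, F.x e k = 0) →
        F.x e i₀ ≠ 0 →
        |K| * (|F.x e i₀| * ∏ i ∈ Cᶜ.erase i₀, |F.β i|) = n := by
      intro e he i₀ hi₀ hek hne
      obtain ⟨z, hz, hz1⟩ := h e he i₀ hi₀ {i₀} (by simpa using hi₀) (by simp) hek
      rw [Finset.sum_singleton, Finset.prod_congr rfl (g := fun i => |F.β i|)] at hz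
      · have hpos : 0 < |K| * (|F.x e i₀| * ∏ i ∈ Cᶜ.erase i₀, |F.β i|) :=
          mul_pos hK0 (mul_pos (abs_pos.2 hne) (Finset.prod_pos fun i _ => hβ i))
        have hz0 : z ≠ 0 := by
          rintro rfl
          rw [hz] at hpos
          simp at hpos
        have : z = 1 := by omega
        rw [hz, this]
        simp
      · intro l hl
        simp [Finset.ne_of_mem_erase hl]
    have hkk : ∀ k ∉ C ∪ {i, j}, F.x (F.k i j) k = 0 := by
      intro k hk
      simp only [Finset.mem_union, Finset.mem_insert, Finset.mem_singleton, not_or] at hk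
      simp [F.x_k i j hij, hk.2.1, hk.2.2]
    have hbk : ∀ l ∈ ({i, j} : Finset ι), ∀ k ∉ C ∪ {i, j}, F.x (F.b l) k = 0 := by
      intro l hl k hk
      have hkl : k ≠ l := by
        rintro rfl
        exact hk (Finset.mem_union_right _ hl)
      simp [F.x_b, hkl]
    have hcmp : ∀ l ∈ ({i, j} : Finset ι), |F.x (F.k i j) l| = |F.a i j| →
        |F.a i j| = |F.β l| := by
      intro l hl hla
      have h1 := hval (F.k i j) (F.k_mem i j hij) l hl hkk (by rw [← abs_pos, hla]; exact ha)
      have h2 := hval (F.b l) (F.b_mem l) l hl (hbk l hl) (by simp [F.x_b, F.β_ne])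
      rw [hla] at h1
      rw [F.x_b, Pi.single_eq_same, ← h1] at h2
      exact (mul_right_cancel₀ (Finset.prod_ne_zero_iff.2 fun i _ => (hβ i).ne')
        (mul_left_cancel₀ hK0.ne' h2)).symm
    refine ⟨hcmp i (by simp) ?_, hcmp j (by simp) ?_⟩
    · simp [F.x_k i j hij, hij]
    · simp [F.x_k i j hij, hij.symm]
  have hβs : ∀ i ∉ C, |F.β i| = |F.β i₁| := by
    intro i hi
    by_cases h : i = i₁
    · rw [h]
    · rw [← (hone i hi i₁ hi₁ h).1, (hone i hi i₁ hi₁ h).2]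
  set s : ℝ := |F.β i₁| with hsdef
  have hs0 : 0 < s := hβ i₁
  have has : ∀ i ∉ C, ∀ j ∉ C, i ≠ j → |F.a i j| = s := fun i hi j hj hij => by
    rw [(hone i hi j hj hij).1, hβs i hi]
  refine ⟨s, hs0, hβs, has, fun e he => ?_⟩
  set T : Finset ι := {k ∈ Cᶜ | F.x e k ≠ 0} with hT
  have hTmem : ∀ k, k ∈ T ↔ k ∉ C ∧ F.x e k ≠ 0 := by simp [hT]
  rcases T.eq_empty_or_nonempty with hT0 | ⟨t₀, ht₀⟩
  · left
    intro i hi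
    by_contra h
    simpa [hT0] using (hTmem i).2 ⟨hi, h⟩
  right
  have hCT : Disjoint C T := Finset.disjoint_right.2 fun k hk => ((hTmem k).1 hk).1
  obtain ⟨n, hn, h⟩ := hstar T hCT
  have hp0 : 0 < s ^ (Cᶜ.card - 1) := pow_pos hs0 _
  -- up to the common factor `γ`, the partial coordinate sums of `e` and the scale `s` are integers
  obtain ⟨γ, hγ, hγs, hγP⟩ : ∃ γ : ℝ, 0 < γ ∧ (∃ z : ℕ, s = γ * z ∧ (T.card ≤ 2 * z → z ≤ 1)) ∧
      ∀ P ⊆ T, P.Nonempty → ∃ z : ℕ, |∑ k ∈ P, F.x e k| = γ * z ∧ (T.card ≤ 2 * z → z ≤ 1) := by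
    have hval : ∀ e ∈ F.E, (∀ k ∉ C ∪ T, F.x e k = 0) → ∀ P ⊆ T, P.Nonempty →
        ∃ z : ℕ, |∑ k ∈ P, F.x e k| = n / (|K| * s ^ (Cᶜ.card - 1)) * z ∧
          (T.card ≤ 2 * z → z ≤ 1) := by
      rintro e he hek P hP ⟨i₀, hi₀⟩
      obtain ⟨z, hz, hz1⟩ := h e he i₀ (hP hi₀) P hP hi₀ hek
      refine ⟨z, ?_, hz1⟩
      have hprod : (∏ i ∈ Cᶜ.erase i₀, if i ∈ P then |F.a i i₀| else |F.β i|) =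
          s ^ (Cᶜ.card - 1) := by
        have hi₀C := ((hTmem i₀).1 (hP hi₀)).1
        rw [← Finset.card_erase_of_mem (Finset.mem_compl.2 hi₀C), ← Finset.prod_const]
        refine Finset.prod_congr rfl fun i hi => ?_
        rw [Finset.mem_erase, Finset.mem_compl] at hi
        split_ifs
        · exact has i hi.2 i₀ hi₀C hi.1
        · exact hβs i hi.2
      rw [hprod] at hz
      field_simp
      linarith
    refine ⟨n / (|K| * s ^ (Cᶜ.card - 1)), by positivity, ?_, ?_⟩
    · obtain ⟨z, hz, hz1⟩ := hval (F.b t₀) (F.b_mem t₀) (by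
        intro k hk
        have hkl : k ≠ t₀ := by
          rintro rfl
          exact hk (Finset.mem_union_right _ ht₀)
        simp [F.x_b, hkl]) {t₀} (by simpa using ht₀) (by simp)
      refine ⟨z, ?_, hz1⟩
      rw [← hz]
      simp [F.x_b, hβs t₀ ((hTmem t₀).1 ht₀).1]
    · refine hval e he fun k hk => ?_
      by_contra h
      exact hk (Finset.mem_union.2 (by
        by_cases hkC : k ∈ C
        · exact Or.inl hkC
        · exact Or.inr ((hTmem k).2 ⟨hkC, h⟩)))
  -- a sign `σ` that at least half of the nonzero coordinates have
  obtain ⟨σ, hσ, hTσ⟩ : ∃ σ : ℝ, |σ| = 1 ∧ T.card ≤ 2 * ({k ∈ T | 0 < σ * F.x e k}).card := by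
    have hsplit : T.card ≤ ({k ∈ T | 0 < F.x e k}).card + ({k ∈ T | 0 < -F.x e k}).card := by
      refine le_trans (Finset.card_le_card ?_) (Finset.card_union_le _ _)
      intro k hk
      rcases lt_or_gt_of_ne ((hTmem k).1 hk).2 with h | h
      · exact Finset.mem_union_right _ (Finset.mem_filter.2 ⟨hk, by linarith⟩)
      · exact Finset.mem_union_left _ (Finset.mem_filter.2 ⟨hk, h⟩)
    rcases le_total ({k ∈ T | 0 < F.x e k}).card ({k ∈ T | 0 < -F.x e k}).card with h | h
    · refine ⟨-1, by simp, ?_⟩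
      simp only [neg_mul, one_mul]
      omega
    · refine ⟨1, by simp, ?_⟩
      simp only [one_mul]
      omega
  set T' : Finset ι := {k ∈ T | 0 < σ * F.x e k} with hT'
  have hT'T : T' ⊆ T := Finset.filter_subset _ _
  have hTpos : 0 < T.card := Finset.card_pos.2 ⟨t₀, ht₀⟩
  have hT'ne : T'.Nonempty := Finset.card_pos.1 (by omega)
  have hγ1 : ∀ k ∈ T, γ ≤ |F.x e k| := by
    intro k hk
    obtain ⟨z, hz, -⟩ := hγP {k} (by simpa using hk) (by simp)
    rw [Finset.sum_singleton] at hz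
    have hz0 : z ≠ 0 := by
      rintro rfl
      have := ((hTmem k).1 hk).2
      simp at hz
      exact this hz
    have : (1 : ℝ) ≤ z := by exact_mod_cast Nat.one_le_iff_ne_zero.2 hz0
    rw [hz]
    nlinarith
  have hT'1 : T'.card = 1 := by
    obtain ⟨z, hz, hz1⟩ := hγP T' hT'T hT'ne
    have hsum : |∑ k ∈ T', F.x e k| = ∑ k ∈ T', |F.x e k| := by
      rw [← one_mul |∑ k ∈ T', F.x e k|, ← hσ, ← abs_mul, Finset.mul_sum,
        abs_of_nonneg (Finset.sum_nonneg fun k hk => (Finset.mem_filter.1 hk).2.le)]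
      refine Finset.sum_congr rfl fun k hk => ?_
      rw [← abs_of_pos (Finset.mem_filter.1 hk).2, abs_mul, hσ, one_mul]
    have hge : T'.card * γ ≤ γ * z := by
      rw [← hz, hsum, ← nsmul_eq_mul]
      exact Finset.card_nsmul_le_sum _ _ _ fun k hk => hγ1 k (hT'T hk)
    have hle : (T'.card : ℝ) ≤ z := by
      rw [mul_comm] at hge
      exact le_of_mul_le_mul_left hge hγ
    have hle' : T'.card ≤ z := by exact_mod_cast hle
    have := Finset.card_pos.2 hT'ne
    have := hz1 (by omega)
    omega
  have hT2 : T.card ≤ 2 := by omega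
  have hsγ : s = γ := by
    obtain ⟨z, hz, hz1⟩ := hγs
    have hz0 : z ≠ 0 := by
      rintro rfl
      simp at hz
      exact hs0.ne' hz
    have : z = 1 := by omega
    rw [hz, this]
    simp
  have hP1 : ∀ P ⊆ T, P.Nonempty → |∑ k ∈ P, F.x e k| ≤ s := by
    intro P hP hPne
    obtain ⟨z, hz, hz1⟩ := hγP P hP hPne
    have : z ≤ 1 := by omega
    have : (z : ℝ) ≤ 1 := by exact_mod_cast this
    rw [hz, hsγ]
    nlinarith
  have hxs : ∀ k ∈ T, |F.x e k| = s := by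
    intro k hk
    refine le_antisymm ?_ (hsγ ▸ hγ1 k hk)
    simpa using hP1 {k} (by simpa using hk) (by simp)
  obtain ⟨i, hi⟩ := Finset.card_eq_one.1 hT'1
  have hiT' : i ∈ T' := by simp [hi]
  have hiT := hT'T hiT'
  have hiC := ((hTmem i).1 hiT).1
  by_cases hex : ∃ j ∈ T, j ≠ i
  · right
    obtain ⟨j, hj, hji⟩ := hex
    refine ⟨i, hiC, j, ((hTmem j).1 hj).1, hji.symm, hxs i hiT, ?_, ?_⟩
    · rcases abs_eq_abs.1 ((hxs j hj).trans (hxs i hiT).symm) with h | h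
      · exfalso
        have h2 := hP1 {i, j} (by simp [Finset.insert_subset_iff, hiT, hj]) (by simp)
        rw [Finset.sum_pair hji.symm, h, ← two_mul, abs_mul, hxs i hiT] at h2
        norm_num at h2
        linarith
      · exact h
    · intro k hk hki hkj
      by_contra hne
      have h3 : ({i, j, k} : Finset ι) ⊆ T := by
        simp [Finset.insert_subset_iff, hiT, hj, (hTmem k).2 ⟨hk, hne⟩]
      have h4 := Finset.card_le_card h3
      rw [Finset.card_eq_three.2 ⟨i, j, k, hji.symm, hki.symm, hkj.symm, rfl⟩] at h4
      omega
  · left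
    push Not at hex
    refine ⟨i, hiC, hxs i hiT, fun k hk hki => ?_⟩
    by_contra hne
    exact hki (hex k ((hTmem k).2 ⟨hk, hne⟩))

end FramedConfig

/-! ### Disjoint elements off the graphic part -/

namespace FramedConfig

variable {ι α : Type*} [Fintype ι] [DecidableEq ι] {Δ : ℕ} {F : FramedConfig ι α Δ}

theorem abs_D_le {h : ι → α} (hh : ∀ i, h i ∈ F.E) : |F.D h| ≤ Δ := by
  obtain ⟨z, hz, he⟩ := F.exists_int h hh
  rw [D, he, ← Int.cast_abs]
  exact_mod_cast hz

theorem one_le_abs_D {h : ι → α} (hh : ∀ i, h i ∈ F.E) (h0 : F.D h ≠ 0) : 1 ≤ |F.D h| := by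
  obtain ⟨z, hz, he⟩ := F.exists_int h hh
  rw [D, he] at h0 ⊢
  rw [← Int.cast_abs]
  have : z ≠ 0 := by exact_mod_cast h0
  exact_mod_cast Int.one_le_abs this

/-- Elements `e t` that join disjoint pairs `i t`, `j t` of vertices outside of `C` are chained, by
elements of the graphic part, to a path. With the vertices in `S` identified to a single vertex, one
determinant is the sum of the determinants of the `e t`, which have the same sign. -/
theorem card_le_of_oriented_pairs {C S : Finset ι} (hSC : S ⊆ C) {s : ℝ}
    (hβ : ∀ i ∉ C, |F.β i| = s) (ha : ∀ i ∉ C, ∀ j ∉ C, i ≠ j → |F.a i j| = s)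
    {m : ℕ} (e : Fin m → α) (i j : Fin m → ι) (he : ∀ t, e t ∈ F.E)
    (hi : ∀ t, i t ∉ C) (hj : ∀ t, j t ∉ C) (hij : ∀ t u, i t ≠ j u)
    (hii : Function.Injective i) (hjj : Function.Injective j)
    (hxi : ∀ t, |F.x (e t) (i t)| = s) (hxj : ∀ t, F.x (e t) (j t) = -F.x (e t) (i t))
    (hx : ∀ t, ∀ k ∉ C, k ≠ i t → k ≠ j t → F.x (e t) k = 0)
    (hpos : ∀ t, 0 < F.x (e t) (i t) * ∑ k ∈ S, F.x (e t) k) : m ≤ Δ := by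
  classical
  rcases m with _ | m
  · exact Nat.zero_le _
  have hη : ∀ t, ∑ k ∈ S, F.x (e t) k ≠ 0 := fun t h => by simpa [h] using hpos t
  have hxne : ∀ t, F.x (e t) (i t) ≠ 0 := fun t h => by simpa [h] using hpos t
  obtain ⟨k₀, hk₀⟩ : S.Nonempty := by
    rw [Finset.nonempty_iff_ne_empty]
    rintro rfl
    simpa using hη 0
  have hk₀C := hSC hk₀
  have hS0 : ∀ l ∉ C, ∀ k ∈ S, k ≠ l := by
    rintro l hl k hk rfl
    exact hl (hSC hk)
  have hiS : ∀ t, i t ∉ S := fun t h => hi t (hSC h)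
  have hjS : ∀ t, j t ∉ S := fun t h => hj t (hSC h)
  have hik : ∀ t, i t ≠ k₀ := fun t h => hi t (h ▸ hk₀C)
  have hjk : ∀ t, j t ≠ k₀ := fun t h => hj t (h ▸ hk₀C)
  -- the elements of the path, each at the position of one of its vertices
  let pI : Fin (m + 1) → α := Fin.cases (F.b (i 0)) fun t => e t.succ
  let pJ : Fin (m + 1) → α :=
    Fin.lastCases (F.b (j (Fin.last m))) fun t => F.k (j t.castSucc) (i t.succ)
  let h : ι → α := fun l => if l = k₀ then e 0 else if l ∈ S then F.k l k₀ else
    Function.extend i pI (Function.extend j pJ F.b) l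
  have hex : ∀ t, ¬ ∃ u, i u = j t := by
    rintro t ⟨u, hu⟩
    exact hij u t hu
  have h_k₀ : h k₀ = e 0 := by simp [h]
  have h_S : ∀ l ∈ S, l ≠ k₀ → h l = F.k l k₀ := by
    intro l hl hne
    simp [h, hl, hne]
  have h_i0 : h (i 0) = F.b (i 0) := by
    simp [h, hik, hiS, hii.extend_apply, pI]
  have h_i : ∀ t : Fin m, h (i t.succ) = e t.succ := by
    intro t
    simp [h, hik, hiS, hii.extend_apply, pI]
  have h_j : ∀ t : Fin m, h (j t.castSucc) = F.k (j t.castSucc) (i t.succ) := by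
    intro t
    simp [h, hjk, hjS, Function.extend_apply' _ _ _ (hex _), hjj.extend_apply, pJ]
  have h_jl : h (j (Fin.last m)) = F.b (j (Fin.last m)) := by
    simp [h, hjk, hjS, Function.extend_apply' _ _ _ (hex _), hjj.extend_apply, pJ]
  have h_o : ∀ l ∉ S, (¬ ∃ t, i t = l) → (¬ ∃ t, j t = l) → h l = F.b l := by
    intro l hl h1 h2
    have : l ≠ k₀ := fun h => hl (h ▸ hk₀)
    simp only [h, this, hl, if_false]
    rw [Function.extend_apply' _ _ _ h1, Function.extend_apply' _ _ _ h2]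
  have hcases : ∀ l, l = k₀ ∨ (l ∈ S ∧ l ≠ k₀) ∨ l = i 0 ∨ (∃ t : Fin m, l = i t.succ) ∨
      (∃ t : Fin m, l = j t.castSucc) ∨ l = j (Fin.last m) ∨
      (l ∉ S ∧ (¬ ∃ t, i t = l) ∧ ¬ ∃ t, j t = l) := by
    intro l
    by_cases h1 : ∃ t, i t = l
    · obtain ⟨t, rfl⟩ := h1
      refine Fin.cases ?_ (fun t => ?_) t
      · simp
      · exact Or.inr (Or.inr (Or.inr (Or.inl ⟨t, rfl⟩)))
    by_cases h2 : ∃ t, j t = l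
    · obtain ⟨t, rfl⟩ := h2
      refine Fin.lastCases ?_ (fun t => ?_) t
      · simp
      · exact Or.inr (Or.inr (Or.inr (Or.inr (Or.inl ⟨t, rfl⟩))))
    by_cases h3 : l = k₀
    · exact Or.inl h3
    by_cases h4 : l ∈ S
    · exact Or.inr (Or.inl ⟨h4, h3⟩)
    · exact Or.inr (Or.inr (Or.inr (Or.inr (Or.inr (Or.inr ⟨h4, h1, h2⟩)))))
  have hhE : ∀ l, h l ∈ F.E := by
    intro l
    rcases hcases l with rfl | ⟨h1, h2⟩ | rfl | ⟨t, rfl⟩ | ⟨t, rfl⟩ | rfl | ⟨h1, h2, h3⟩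
    · rw [h_k₀]; exact he 0
    · rw [h_S l h1 h2]; exact F.k_mem _ _ h2
    · rw [h_i0]; exact F.b_mem _
    · rw [h_i]; exact he _
    · rw [h_j]; exact F.k_mem _ _ (hij _ _).symm
    · rw [h_jl]; exact F.b_mem _
    · rw [h_o l h1 h2 h3]; exact F.b_mem _
  -- the coordinate vectors after the identification of the vertices in `S`
  let y : α → ι → ℝ := fun e => Function.update (F.x e) k₀ (∑ k ∈ S, F.x e k)
  have hDR : F.D h = F.d * (Matrix.of fun l => y (h l)).det := by
    rw [D, ← Matrix.det_sum_col S k₀ hk₀]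
  have y_b : ∀ l, l ∉ S → y (F.b l) = Pi.single l (F.β l) := by
    intro l hl
    ext q
    by_cases hq : q = k₀
    · subst hq
      have : q ≠ l := fun h => hl (h ▸ hk₀)
      simp [y, F.x_b, hl, this]
    · simp [y, F.x_b, hq]
  have y_S : ∀ l ∈ S, l ≠ k₀ → y (F.k l k₀) = Pi.single l (F.a l k₀) := by
    intro l hl hne
    ext q
    by_cases hq : q = k₀
    · subst hq
      simp [y, F.x_k _ _ hne, hne.symm, hl, hk₀]
    · simp [y, F.x_k _ _ hne, hq]
  have y_k : ∀ l l', l ∉ S → l' ∉ S → l ≠ l' →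
      y (F.k l l') = Pi.single l (F.a l l') - Pi.single l' (F.a l l') := by
    intro l l' hl hl' hne
    ext q
    by_cases hq : q = k₀
    · subst hq
      have h1 : q ≠ l := fun h => hl (h ▸ hk₀)
      have h2 : q ≠ l' := fun h => hl' (h ▸ hk₀)
      simp [y, F.x_k _ _ hne, hl, hl', h1, h2]
    · simp [y, F.x_k _ _ hne, hq]
  have y_e : ∀ t, ∀ q ∉ C, y (e t) q =
      F.x (e t) (i t) * ((Pi.single (i t) 1 : ι → ℝ) q - (Pi.single (j t) 1 : ι → ℝ) q) := by
    intro t q hq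
    have hqk : q ≠ k₀ := fun h => hq (h ▸ hk₀C)
    by_cases h1 : q = i t
    · simp [y, h1, hij, hik]
    · by_cases h2 : q = j t
      · simp [y, h2, (hij t t).symm, hjk, hxj]
      · simp [y, hqk, h1, h2, hx t q hq h1 h2]
  have hβne : ∀ l, F.β l ≠ 0 := F.β_ne
  have hjia : ∀ t : Fin m, F.a (j t.castSucc) (i t.succ) ≠ 0 := fun t => F.a_ne _ _ (hij _ _).symm
  set R : Matrix ι ι ℝ := Matrix.of fun l => y (h l) with hR
  -- the sum of the rows along the path, in which the vertices outside of `C` cancel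
  let v : ι → ℝ := (1 / F.x (e 0) (i 0)) • R k₀ - (1 / F.β (i 0)) • R (i 0)
    + ∑ t : Fin m, (1 / F.x (e t.succ) (i t.succ)) • R (i t.succ)
    + ∑ t : Fin m, (1 / F.a (j t.castSucc) (i t.succ)) • R (j t.castSucc)
    + (1 / F.β (j (Fin.last m))) • R (j (Fin.last m))
  have hRk₀ : R k₀ = y (e 0) := by rw [← h_k₀]; rfl
  have hRi0 : R (i 0) = Pi.single (i 0) (F.β (i 0)) := by
    rw [← y_b _ (hiS 0), ← h_i0]; rfl
  have hRi : ∀ t : Fin m, R (i t.succ) = y (e t.succ) := fun t => by rw [← h_i]; rfl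
  have hRj : ∀ t : Fin m, R (j t.castSucc) = Pi.single (j t.castSucc)
      (F.a (j t.castSucc) (i t.succ)) - Pi.single (i t.succ) (F.a (j t.castSucc) (i t.succ)) := by
    intro t
    rw [← y_k _ _ (hjS _) (hiS _) (hij _ _).symm, ← h_j]; rfl
  have hRjl : R (j (Fin.last m)) = Pi.single (j (Fin.last m)) (F.β (j (Fin.last m))) := by
    rw [← y_b _ (hjS _), ← h_jl]; rfl
  have hRS : ∀ l ∈ S, l ≠ k₀ → R l = Pi.single l (F.a l k₀) := by
    intro l h1 h2
    rw [← y_S l h1 h2, ← h_S l h1 h2]; rfl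
  have hRo : ∀ l ∉ S, (¬ ∃ t, i t = l) → (¬ ∃ t, j t = l) → R l = Pi.single l (F.β l) := by
    intro l h1 h2 h3
    rw [← y_b l h1, ← h_o l h1 h2 h3]; rfl
  have hsingle : ∀ (l : ι) (c : ℝ) (q : ι), (Pi.single l c : ι → ℝ) q =
      c * (Pi.single l 1 : ι → ℝ) q := by
    intro l c q
    by_cases hq : q = l
    · simp [hq]
    · simp [hq]
  have hvC : ∀ q ∉ C, v q = 0 := by
    intro q hq
    simp only [v, Pi.add_apply, Pi.sub_apply, Pi.smul_apply, Finset.sum_apply, smul_eq_mul, hRk₀,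
      hRi0, hRi, hRj, hRjl, y_e _ q hq]
    simp only [hsingle _ (F.β _), hsingle _ (F.a _ _), ← mul_sub]
    have c1 : ∀ a b : ℝ, a ≠ 0 → 1 / a * (a * b) = b := fun a b h => by field_simp
    simp only [c1 _ _ (hxne _), c1 _ _ (hβne _), c1 _ _ (hjia _)]
    rw [Finset.sum_sub_distrib, Finset.sum_sub_distrib]
    have e1 := Fin.sum_univ_succ (fun t => (Pi.single (j t) 1 : ι → ℝ) q)
    have e2 := Fin.sum_univ_castSucc (fun t => (Pi.single (j t) 1 : ι → ℝ) q)
    linarith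
  have hvk₀ : v k₀ = ∑ t, (1 / F.x (e t) (i t)) * ∑ k ∈ S, F.x (e t) k := by
    rw [Fin.sum_univ_succ]
    simp only [v, Pi.add_apply, Pi.sub_apply, Pi.smul_apply, Finset.sum_apply, smul_eq_mul, hRk₀,
      hRi0, hRi, hRj, hRjl]
    simp [y, (hik _).symm, (hjk _).symm]
  have hφ : (R.updateRow k₀ v).det = (1 / F.x (e 0) (i 0)) * R.det := by
    rw [← Matrix.cramer_transpose_apply]
    simp only [v, map_add, map_sub, map_sum, map_smul, Matrix.cramer_transpose_row_self]
    simp [(hik _).symm, (hjk _).symm]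
  -- in the order given by `key`, the rows form a triangular matrix: the path first, then the sum
  -- of its rows at the position `k₀`, and the other vertices in `C` last
  let key : ι → ℕ := fun l => if l = k₀ then 2 * m + 10 else if l ∈ C then 2 * m + 11 else
    Function.extend i (fun t => 2 * t.val + 1) (Function.extend j (fun t => 2 * t.val + 2) 0) l
  have key_i : ∀ t, key (i t) = 2 * t.val + 1 := by
    intro t
    simp [key, hik, hi, hii.extend_apply]
  have key_j : ∀ t, key (j t) = 2 * t.val + 2 := by
    intro t
    simp [key, hjk, hj, Function.extend_apply' _ _ _ (hex _), hjj.extend_apply]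
  have key_C : ∀ l ∈ C, 2 * m + 10 ≤ key l := by
    intro l hl
    by_cases hlk : l = k₀
    · simp [key, hlk]
    · simp [key, hlk, hl]
  have hdet : (R.updateRow k₀ v).det = v k₀ * ∏ l ∈ Finset.univ.erase k₀, R l l := by
    rw [Matrix.det_eq_prod_diag_of_key _ key, ← Finset.mul_prod_erase _ _ (Finset.mem_univ k₀)]
    · rw [Matrix.updateRow_self]
      congr 1
      refine Finset.prod_congr rfl fun l hl => ?_
      rw [Matrix.updateRow_ne (Finset.ne_of_mem_erase hl)]
    · intro l q hlq hkey
      by_cases hlk : l = k₀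
      · subst hlk
        rw [Matrix.updateRow_self]
        refine hvC q fun hq => ?_
        simp only [key, hq, hlq.symm, if_true, if_false] at hkey
        omega
      rw [Matrix.updateRow_ne hlk]
      rcases hcases l with rfl | ⟨h1, h2⟩ | rfl | ⟨t, rfl⟩ | ⟨t, rfl⟩ | rfl | ⟨h1, h2, h3⟩
      · exact absurd rfl hlk
      · rw [hRS l h1 h2]
        simp [hlq.symm]
      · rw [hRi0]
        simp [hlq.symm]
      · rw [hRi]
        have hqC : q ∉ C := by
          intro hq
          have := key_C q hq
          have := t.2
          rw [key_i, Fin.val_succ] at hkey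
          omega
        have hqj : q ≠ j t.succ := by
          rintro rfl
          rw [key_i, key_j] at hkey
          omega
        rw [y_e _ q hqC]
        simp [hlq.symm, hqj]
      · rw [hRj]
        have hqi : q ≠ i t.succ := by
          rintro rfl
          rw [key_i, key_j, Fin.val_succ, Fin.val_castSucc] at hkey
          omega
        simp [hlq.symm, hqi]
      · rw [hRjl]
        simp [hlq.symm]
      · rw [hRo l h1 h2 h3]
        simp [hlq.symm]
  set Γ : ℝ := |F.d| * ∏ l ∈ Finset.univ.erase k₀, |if l ∈ S then F.a l k₀ else F.β l| with hΓ
  have hΓ1 : ∀ t, 1 ≤ Γ * |∑ k ∈ S, F.x (e t) k| := by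
    intro t
    have h1 := D_star (F := F) ∅ (F.star (e t) k₀ S) (by simp) (e t) k₀ S hk₀ (by simp)
    rw [Finset.piecewise_empty] at h1
    have h2 : F.D (F.star (e t) k₀ S) = F.d * ((∑ k ∈ S, F.x (e t) k) *
        ∏ l ∈ Finset.univ.erase k₀, if l ∈ S then F.a l k₀ else F.β l) := by
      rw [h1, Finset.compl_empty]
      have : IsEmpty {l : ι // ¬ l ∉ (∅ : Finset ι)} := ⟨fun l => by simpa using l.2⟩
      rw [Matrix.det_isEmpty, mul_one]
    have h3 : F.D (F.star (e t) k₀ S) ≠ 0 := by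
      rw [h2]
      refine mul_ne_zero F.d_ne (mul_ne_zero (hη t) (Finset.prod_ne_zero_iff.2 fun l hl => ?_))
      split_ifs
      · exact F.a_ne _ _ (Finset.ne_of_mem_erase hl)
      · exact F.β_ne l
    have h4 := one_le_abs_D (star_mem (he t) k₀ S) h3
    rw [h2, abs_mul, abs_mul, Finset.abs_prod] at h4
    rw [hΓ]
    linarith
  have hprod : ∏ l ∈ Finset.univ.erase k₀, |R l l| =
      ∏ l ∈ Finset.univ.erase k₀, |if l ∈ S then F.a l k₀ else F.β l| := by
    refine Finset.prod_congr rfl fun l hl => ?_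
    have hlk := Finset.ne_of_mem_erase hl
    rcases hcases l with rfl | ⟨h1, h2⟩ | rfl | ⟨t, rfl⟩ | ⟨t, rfl⟩ | rfl | ⟨h1, h2, h3⟩
    · exact absurd rfl hlk
    · simp [hRS l h1 h2, h1]
    · simp [hRi0, hiS]
    · rw [hRi, y_e _ _ (hi _)]
      simp [hiS, hij, hxi, hβ _ (hi _)]
    · rw [hRj]
      simp [hjS, hβ _ (hj _), ha _ (hj _) _ (hi _) (hij _ _).symm, (hij _ _).symm]
    · simp [hRjl, hjS]
    · simp [hRo l h1 h2 h3, h1]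
  have hfinal : Γ * (∑ t, |∑ k ∈ S, F.x (e t) k|) ≤ Δ := by
    refine le_trans (le_of_eq ?_) (abs_D_le hhE)
    have h1 : R.det = F.x (e 0) (i 0) * (v k₀ * ∏ l ∈ Finset.univ.erase k₀, R l l) := by
      rw [← hdet, hφ]
      field_simp [hxne 0]
    have h2 : s * |v k₀| = ∑ t, |∑ k ∈ S, F.x (e t) k| := by
      rw [hvk₀, abs_of_pos, Finset.mul_sum]
      · refine Finset.sum_congr rfl fun t _ => ?_
        have h3 := hpos t
        rw [← abs_of_pos h3, abs_mul, hxi] at h3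
        rcases lt_or_gt_of_ne (hxne t) with h4 | h4
        · have h5 : ∑ k ∈ S, F.x (e t) k < 0 := by
            have := hpos t
            nlinarith
          have h6 := hxi t
          rw [abs_of_neg h4] at h6
          rw [abs_of_neg h5, ← h6]
          field_simp [hxne t]
        · have h5 : 0 < ∑ k ∈ S, F.x (e t) k := by
            have := hpos t
            nlinarith
          have h6 := hxi t
          rw [abs_of_pos h4] at h6
          rw [abs_of_pos h5, ← h6]
          field_simp [hxne t]
      · refine Finset.sum_pos (fun t _ => ?_) ⟨0, Finset.mem_univ _⟩
        have h3 := hpos t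
        have h4 : 1 / F.x (e t) (i t) * ∑ k ∈ S, F.x (e t) k =
            (F.x (e t) (i t) * ∑ k ∈ S, F.x (e t) k) / F.x (e t) (i t) ^ 2 := by
          field_simp [hxne t]
        rw [h4]
        exact div_pos h3 (pow_pos (abs_pos.2 (hxne t)) 2 |>.trans_eq (sq_abs _))
    rw [hDR, h1, abs_mul, abs_mul, abs_mul, Finset.abs_prod, hprod, hxi, hΓ, ← h2]
    ring
  have hΓ0 : ((m + 1 : ℕ) : ℝ) ≤ Δ := by
    refine le_trans ?_ hfinal
    rw [Finset.mul_sum]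
    have := Finset.card_nsmul_le_sum (Finset.univ : Finset (Fin (m + 1)))
      (fun t => Γ * |∑ k ∈ S, F.x (e t) k|) 1 fun t _ => hΓ1 t
    simpa using this
  exact_mod_cast hΓ0

/-- Among subsets of `C`, at least one half have a nonzero sum of values of a nonzero function. -/
theorem _root_.Finset.two_mul_card_filter_sum_ne_zero {ι : Type*} [DecidableEq ι] (C : Finset ι)
    (f : ι → ℝ) (hf : ∃ k ∈ C, f k ≠ 0) :
    C.powerset.card ≤ 2 * {S ∈ C.powerset | ∑ k ∈ S, f k ≠ 0}.card := by
  obtain ⟨k, hk, hfk⟩ := hf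
  have h1 := Finset.card_filter_add_card_filter_not (s := C.powerset)
    (fun S => ∑ k ∈ S, f k ≠ 0)
  -- toggling `k` maps the sets with sum zero to sets with nonzero sum
  have h2 : {S ∈ C.powerset | ¬ ∑ k ∈ S, f k ≠ 0}.card ≤
      {S ∈ C.powerset | ∑ k ∈ S, f k ≠ 0}.card := by
    refine Finset.card_le_card_of_injOn (fun S => symmDiff S {k}) ?_ ?_
    · intro S hS
      simp only [Finset.coe_filter, Finset.mem_powerset, Set.mem_ofPred_eq, not_not] at hS ⊢
      by_cases hkS : k ∈ S
      · have : symmDiff S {k} = S.erase k := by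
          ext x
          by_cases hx : x = k <;> simp [Finset.mem_symmDiff, hx, hkS]
        rw [this]
        refine ⟨(Finset.erase_subset _ _).trans hS.1, ?_⟩
        have := Finset.add_sum_erase S f hkS
        intro h0
        rw [h0, hS.2, add_zero] at this
        exact hfk this
      · have : symmDiff S {k} = insert k S := by
          ext x
          by_cases hx : x = k <;> simp [Finset.mem_symmDiff, hx, hkS]
        rw [this]
        refine ⟨Finset.insert_subset hk hS.1, ?_⟩
        rw [Finset.sum_insert hkS, hS.2, add_zero]
        exact hfk
    · intro S _ T _ h
      exact symmDiff_left_injective _ h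
  omega

/-- There are few disjoint pairs of vertices outside of `C` which are joined by elements off the
graphic part. A suitable set `S ⊆ C` gives a nonzero coordinate sum for at least half of these
elements, and an orientation of the pairs makes the signs agree. -/
theorem card_le_of_pairs {C : Finset ι} {s : ℝ} (hs : 0 < s)
    (hβ : ∀ i ∉ C, |F.β i| = s) (ha : ∀ i ∉ C, ∀ j ∉ C, i ≠ j → |F.a i j| = s)
    {m : ℕ} (e : Fin m → α) (i j : Fin m → ι) (he : ∀ t, e t ∈ F.E)
    (hi : ∀ t, i t ∉ C) (hj : ∀ t, j t ∉ C) (hij : ∀ t u, i t ≠ j u)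
    (hii : Function.Injective i) (hjj : Function.Injective j)
    (hxi : ∀ t, |F.x (e t) (i t)| = s) (hxj : ∀ t, F.x (e t) (j t) = -F.x (e t) (i t))
    (hx : ∀ t, ∀ k ∉ C, k ≠ i t → k ≠ j t → F.x (e t) k = 0)
    (hne : ∀ t, ∃ k ∈ C, F.x (e t) k ≠ 0) : m ≤ 2 * Δ := by
  classical
  obtain ⟨S, hSC, hS⟩ : ∃ S ∈ C.powerset,
      m ≤ 2 * (Finset.univ.filter fun t : Fin m => ∑ k ∈ S, F.x (e t) k ≠ 0).card := by
    by_contra! hcon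
    have h1 : ∑ S ∈ C.powerset,
        2 * (Finset.univ.filter fun t : Fin m => ∑ k ∈ S, F.x (e t) k ≠ 0).card <
        ∑ S ∈ C.powerset, m :=
      Finset.sum_lt_sum_of_nonempty ⟨∅, by simp⟩ hcon
    have h2 : ∑ S ∈ C.powerset,
        (Finset.univ.filter fun t : Fin m => ∑ k ∈ S, F.x (e t) k ≠ 0).card =
        ∑ t : Fin m, {S ∈ C.powerset | ∑ k ∈ S, F.x (e t) k ≠ 0}.card := by
      simp only [Finset.card_filter]
      exact Finset.sum_comm
    have h3 : ∑ t : Fin m, C.powerset.card ≤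
        ∑ t : Fin m, 2 * {S ∈ C.powerset | ∑ k ∈ S, F.x (e t) k ≠ 0}.card :=
      Finset.sum_le_sum fun t _ =>
        Finset.two_mul_card_filter_sum_ne_zero C (F.x (e t)) (hne t)
    rw [← Finset.mul_sum, ← h2, Finset.mul_sum] at h3
    simp only [Finset.sum_const, Finset.card_univ, Fintype.card_fin, smul_eq_mul] at h1 h3
    rw [mul_comm] at h1
    omega
  set T := (Finset.univ.filter fun t : Fin m => ∑ k ∈ S, F.x (e t) k ≠ 0) with hT
  rw [Finset.mem_powerset] at hSC
  let u : Fin T.card → Fin m := T.orderEmbOfFin rfl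
  have hu : Function.Injective u := (T.orderEmbOfFin rfl).injective
  have huT : ∀ t, ∑ k ∈ S, F.x (e (u t)) k ≠ 0 := by
    intro t
    exact (Finset.mem_filter.1 (T.orderEmbOfFin_mem rfl t)).2
  -- the orientation of the pair `u t` for which the determinants are positive
  let p : Fin T.card → Prop := fun t => 0 < F.x (e (u t)) (i (u t)) * ∑ k ∈ S, F.x (e (u t)) k
  have hxne : ∀ t, F.x (e t) (i t) ≠ 0 := fun t => by
    rw [← abs_pos, hxi]
    exact hs
  have hm : T.card ≤ Δ := by
    refine card_le_of_oriented_pairs hSC hβ ha (fun t => e (u t))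
      (fun t => if p t then i (u t) else j (u t)) (fun t => if p t then j (u t) else i (u t))
      (fun t => he _) ?_ ?_ ?_ ?_ ?_ ?_ ?_ ?_ ?_
    · intro t
      split_ifs
      · exact hi _
      · exact hj _
    · intro t
      split_ifs
      · exact hj _
      · exact hi _
    · intro t t'
      split_ifs with h1 h2 h2
      · exact hij _ _
      · intro h
        have := hu (hii h)
        subst this
        exact h2 h1
      · intro h
        have := hu (hjj h)
        subst this
        exact h1 h2
      · exact (hij _ _).symm
    · intro t t' h
      dsimp only at h
      split_ifs at h
      · exact hu (hii h)
      · exact absurd h (hij _ _)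
      · exact absurd h.symm (hij _ _)
      · exact hu (hjj h)
    · intro t t' h
      dsimp only at h
      split_ifs at h
      · exact hu (hjj h)
      · exact absurd h.symm (hij _ _)
      · exact absurd h (hij _ _)
      · exact hu (hii h)
    · intro t
      split_ifs
      · exact hxi _
      · rw [hxj, abs_neg, hxi]
    · intro t
      split_ifs
      · exact hxj _
      · rw [hxj, neg_neg]
    · intro t k hk h1 h2
      split_ifs at h1 h2
      · exact hx _ k hk h1 h2
      · exact hx _ k hk h2 h1
    · intro t
      split_ifs with h
      · exact h
      · rw [hxj, neg_mul, Left.neg_pos_iff]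
        exact lt_of_le_of_ne (not_lt.1 h) (mul_ne_zero (hxne _) (huT t))
  omega

variable (F) in
/-- There is a small set `B'` of frame elements such that each element off the graphic part is a loop
or parallel to a frame element after contraction of `B'`: besides the set `C` it contains the
vertices of a maximal matching of pairs that are joined by elements off the graphic part. -/
theorem exists_contraction_set : ∃ B' : Finset ι, B'.card ≤ 6 * Δ ∧ (Δ = 1 → B' = ∅) ∧
    ∀ e ∈ F.E, (∃ i j, i ≠ j ∧ F.x e j = -F.x e i ∧ ∀ k, k ≠ i → k ≠ j → F.x e k = 0) ∨
      (∀ i ∉ B', ∀ j ∉ B', F.x e i ≠ 0 → F.x e j ≠ 0 → i = j) := by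
  classical
  obtain ⟨C, hC, hC1, s, hs, hβ, ha, hE⟩ := F.exists_graphic_mod
  -- the sizes of the matchings formed by elements off the graphic part
  let P : ℕ → Prop := fun m => ∃ (e : Fin m → α) (i j : Fin m → ι), (∀ t, e t ∈ F.E) ∧
    (∀ t, i t ∉ C) ∧ (∀ t, j t ∉ C) ∧ (∀ t u, i t ≠ j u) ∧ Function.Injective i ∧
    Function.Injective j ∧ (∀ t, |F.x (e t) (i t)| = s) ∧
    (∀ t, F.x (e t) (j t) = -F.x (e t) (i t)) ∧
    (∀ t, ∀ k ∉ C, k ≠ i t → k ≠ j t → F.x (e t) k = 0) ∧ ∀ t, ∃ k ∈ C, F.x (e t) k ≠ 0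
  have hP0 : P 0 := ⟨Fin.elim0, Fin.elim0, Fin.elim0, fun t => t.elim0, fun t => t.elim0,
    fun t => t.elim0, fun t => t.elim0, fun t => t.elim0, fun t => t.elim0, fun t => t.elim0,
    fun t => t.elim0, fun t => t.elim0, fun t => t.elim0⟩
  have hle : ∀ m, P m → m ≤ 2 * Δ := by
    rintro m ⟨e, i, j, he, hi, hj, hij, hii, hjj, hxi, hxj, hx, hne⟩
    exact card_le_of_pairs hs hβ ha e i j he hi hj hij hii hjj hxi hxj hx hne
  have hspec : P (Nat.findGreatest P (2 * Δ)) := Nat.findGreatest_spec (Nat.zero_le _) hP0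
  have hmax : ¬ P (Nat.findGreatest P (2 * Δ) + 1) := fun h => by
    have := Nat.le_findGreatest (hle _ h) h
    omega
  have hm := Nat.findGreatest_le (P := P) (2 * Δ)
  generalize Nat.findGreatest P (2 * Δ) = m at hspec hmax hm
  obtain ⟨e, i, j, he, hi, hj, hij, hii, hjj, hxi, hxj, hx, hne⟩ := hspec
  refine ⟨C ∪ (Finset.univ.image i ∪ Finset.univ.image j), ?_, fun h1 => ?_, fun f hf => ?_⟩
  · have h1 : (Finset.univ.image i).card ≤ m := by
      simpa using Finset.card_image_le (s := Finset.univ) (f := i)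
    have h2 : (Finset.univ.image j).card ≤ m := by
      simpa using Finset.card_image_le (s := Finset.univ) (f := j)
    have h3 := Finset.card_union_le C (Finset.univ.image i ∪ Finset.univ.image j)
    have h4 := Finset.card_union_le (Finset.univ.image i) (Finset.univ.image j)
    omega
  · have hC0 := hC1 h1
    have : IsEmpty (Fin m) := ⟨fun t => by
      obtain ⟨k, hk, -⟩ := hne t
      simp [hC0] at hk⟩
    simp [hC0]
  · by_contra! hcon
    obtain ⟨hK, i', hi', j', hj', hi0, hj0, hij'⟩ := hcon
    simp only [Finset.mem_union, Finset.mem_image, Finset.mem_univ, true_and, not_or,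
      not_exists] at hi' hj'
    rcases hE f hf with h | ⟨l, hl, -, h⟩ | ⟨l, hl, l', hl', hll, hls, hln, h⟩
    · exact hi0 (h i' hi'.1)
    · have h1 : i' = l := by
        by_contra hne
        exact hi0 (h i' hi'.1 hne)
      have h2 : j' = l := by
        by_contra hne
        exact hj0 (h j' hj'.1 hne)
      exact hij' (h1.trans h2.symm)
    · obtain ⟨k, hk1, hk2, hk3⟩ := hK l l' hll hln
      have hkC : k ∈ C := by
        by_contra hk
        exact hk3 (h k hk hk1 hk2)
      -- the vertices `l` and `l'` are `i'` and `j'`, and hence not in the maximal matching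
      have hi'' : i' = l ∨ i' = l' := by
        by_contra! hne
        exact hi0 (h i' hi'.1 hne.1 hne.2)
      have hj'' : j' = l ∨ j' = l' := by
        by_contra! hne
        exact hj0 (h j' hj'.1 hne.1 hne.2)
      have hlm : (∀ t, i t ≠ l) ∧ (∀ t, j t ≠ l) ∧ (∀ t, i t ≠ l') ∧ ∀ t, j t ≠ l' := by
        rcases hi'' with rfl | rfl <;> rcases hj'' with rfl | rfl
        · exact absurd rfl hij'
        · exact ⟨hi'.2.1, hi'.2.2, hj'.2.1, hj'.2.2⟩
        · exact ⟨hj'.2.1, hj'.2.2, hi'.2.1, hi'.2.2⟩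
        · exact absurd rfl hij'
      refine hmax ⟨Fin.cons f e, Fin.cons l i, Fin.cons l' j, ?_, ?_, ?_, ?_, ?_, ?_, ?_, ?_, ?_, ?_⟩
      · exact Fin.cases hf he
      · exact Fin.cases hl hi
      · exact Fin.cases hl' hj
      · refine Fin.cases (Fin.cases hll fun t => (hlm.2.1 t).symm) fun t => ?_
        exact Fin.cases (hlm.2.2.1 t) fun u => hij t u
      · refine Fin.cons_injective_iff.2 ⟨?_, hii⟩
        rintro ⟨t, ht⟩
        exact hlm.1 t ht
      · refine Fin.cons_injective_iff.2 ⟨?_, hjj⟩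
        rintro ⟨t, ht⟩
        exact hlm.2.2.2 t ht
      · exact Fin.cases hls hxi
      · exact Fin.cases hln hxj
      · exact Fin.cases h hx
      · exact Fin.cases ⟨k, hkC, hk3⟩ hne

end FramedConfig

/-! ### Counting vectors with bounded minors -/

namespace Finset

variable {ι : Type*} [DecidableEq ι]

/-- The Sauer-Shelah bound for families of subsets of `T`. -/
theorem card_le_sum_choose_of_not_shatters {𝒜 : Finset (Finset ι)} {T : Finset ι} {d : ℕ}
    (hT : ∀ t ∈ 𝒜, t ⊆ T) (h : ∀ s ⊆ T, s.card = d → ¬ 𝒜.Shatters s) :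
    𝒜.card ≤ ∑ j ∈ range d, T.card.choose j := by
  have hsub : 𝒜.shatterer ⊆ (range d).biUnion fun j => T.powersetCard j := by
    intro s hs
    rw [mem_shatterer] at hs
    obtain ⟨t, ht, hst⟩ := hs.exists_superset
    have hsT := hst.trans (hT t ht)
    rw [mem_biUnion]
    refine ⟨s.card, ?_, mem_powersetCard.2 ⟨hsT, rfl⟩⟩
    rw [mem_range]
    by_contra! hd
    obtain ⟨s', hs', hcard⟩ := exists_subset_card_eq hd
    exact h s' (hs'.trans hsT) hcard (hs.mono_right hs')
  calc 𝒜.card ≤ 𝒜.shatterer.card := card_le_card_shatterer 𝒜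
    _ ≤ _ := card_le_card hsub
    _ ≤ ∑ j ∈ range d, (T.powersetCard j).card := card_biUnion_le
    _ = _ := by simp

end Finset

/-- The minors of the vectors `u e`, for `e ∈ F`, on rows in `S` are at most one in absolute
value. -/
def MinorsLeOne {ι α : Type*} (u : α → ι → ℝ) (F : Finset α) (S : Finset ι) : Prop :=
  ∀ (k : ℕ) (e : Fin k → α) (i : Fin k → ι), (∀ a, e a ∈ F) → Function.Injective i →
    (∀ c, i c ∈ S) → |(Matrix.of fun a c => u (e a) (i c)).det| ≤ 1

namespace MinorsLeOne

variable {ι α : Type*} {u : α → ι → ℝ} {F : Finset α} {S : Finset ι}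

theorem mono {G : Finset α} (h : MinorsLeOne u F S) (hG : G ⊆ F) : MinorsLeOne u G S :=
  fun k e i he => h k e i fun a => hG (he a)

theorem abs_le_one (h : MinorsLeOne u F S) {e : α} (he : e ∈ F) {i : ι} (hi : i ∈ S) :
    |u e i| ≤ 1 := by
  have := h 1 (fun _ => e) (fun _ => i) (fun _ => he) (fun _ _ _ => Subsingleton.elim _ _)
    fun _ => hi
  simpa using this

theorem abs_two_le_one (h : MinorsLeOne u F S) {e f : α} (he : e ∈ F) (hf : f ∈ F) {i j : ι}
    (hi : i ∈ S) (hj : j ∈ S) (hij : i ≠ j) : |u e i * u f j - u e j * u f i| ≤ 1 := by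
  have := h 2 ![e, f] ![i, j] (by simp [Fin.forall_fin_two, he, hf])
    (by
      intro a b hab
      fin_cases a <;> fin_cases b <;> simp_all [hij.symm])
    (by simp [Fin.forall_fin_two, hi, hj])
  simpa [Matrix.det_fin_two] using this

/-- Two entries `±1` of one vector and of another one agree up to a common sign. -/
theorem mul_eq_mul (h : MinorsLeOne u F S) {e f : α} (he : e ∈ F) (hf : f ∈ F) {i j : ι}
    (hi : i ∈ S) (hj : j ∈ S) (hij : i ≠ j) (hei : |u e i| = 1) (hej : |u e j| = 1)
    (hfi : |u f i| = 1) (hfj : |u f j| = 1) : u e i * u f j = u e j * u f i := by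
  have h2 := h.abs_two_le_one he hf hi hj hij
  rcases eq_or_eq_neg_of_abs_eq hei with h3 | h3 <;> rcases eq_or_eq_neg_of_abs_eq hej with h4 | h4 <;>
    rcases eq_or_eq_neg_of_abs_eq hfi with h5 | h5 <;>
    rcases eq_or_eq_neg_of_abs_eq hfj with h6 | h6 <;>
    rw [h3, h4, h5, h6] at h2 ⊢ <;> first | (norm_num at h2; done) | norm_num

/-- The supports of vectors with entries in `{0, 1, -1}` shatter no set of size three, since this
would represent the Fano matroid over the reals. -/
theorem not_shatters_three [DecidableEq ι] (h : MinorsLeOne u F S) {I : Finset ι} (hI : I ⊆ S)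
    (h01 : ∀ e ∈ F, ∀ i ∈ I, |u e i| = 1 ∨ u e i = 0) {s : Finset ι} (hs : s ⊆ I)
    (hcard : s.card = 3) :
    ¬ (F.image fun e => {i ∈ S | |u e i| = 1}).Shatters s := by
  intro hsh
  obtain ⟨i, j, k, hij, hik, hjk, rfl⟩ := Finset.card_eq_three.1 hcard
  have hiI : i ∈ I := hs (by simp)
  have hjI : j ∈ I := hs (by simp)
  have hkI : k ∈ I := hs (by simp)
  have key : ∀ t ⊆ ({i, j, k} : Finset ι), ∃ e ∈ F, ∀ l ∈ ({i, j, k} : Finset ι),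
      (l ∈ t → |u e l| = 1) ∧ (l ∉ t → u e l = 0) := by
    intro t ht
    obtain ⟨v, hv, hvt⟩ := hsh ht
    obtain ⟨e, he, rfl⟩ := Finset.mem_image.1 hv
    refine ⟨e, he, fun l hl => ?_⟩
    have hlt : l ∈ t ↔ |u e l| = 1 := by
      rw [← hvt, Finset.mem_inter, and_iff_right hl, Finset.mem_filter,
        and_iff_right (hI (hs hl))]
    exact ⟨hlt.1, fun hnt => (h01 e he l (hs hl)).resolve_left fun h1 => hnt (hlt.2 h1)⟩
  obtain ⟨p, hp, hp'⟩ := key {i, j, k} subset_rfl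
  obtain ⟨a, haF, ha⟩ := key {j, k} (by simp [Finset.subset_iff])
  obtain ⟨b, hbF, hb⟩ := key {i, k} (by simp [Finset.subset_iff])
  obtain ⟨c, hcF, hc⟩ := key {i, j} (by simp [Finset.subset_iff])
  have pi := (hp' i (by simp)).1 (by simp)
  have pj := (hp' j (by simp)).1 (by simp)
  have pk := (hp' k (by simp)).1 (by simp)
  have ai := (ha i (by simp)).2 (by simp [hij, hik])
  have aj := (ha j (by simp)).1 (by simp)
  have ak := (ha k (by simp)).1 (by simp)
  have bi := (hb i (by simp)).1 (by simp)
  have bj := (hb j (by simp)).2 (by simp [hij.symm, hjk])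
  have bk := (hb k (by simp)).1 (by simp)
  have ci := (hc i (by simp)).1 (by simp)
  have cj := (hc j (by simp)).1 (by simp)
  have ck := (hc k (by simp)).2 (by simp [hik.symm, hjk.symm])
  have e1 := h.mul_eq_mul hp haF (hI hjI) (hI hkI) hjk pj pk aj ak
  have e2 := h.mul_eq_mul hp hbF (hI hiI) (hI hkI) hik pi pk bi bk
  have e3 := h.mul_eq_mul hp hcF (hI hiI) (hI hjI) hij pi pj ci cj
  have hdet := h 3 ![a, b, c] ![i, j, k] (by simp [Fin.forall_fin_succ, haF, hbF, hcF])
    (by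
      intro x y hxy
      fin_cases x <;> fin_cases y <;> simp_all)
    (by simp [Fin.forall_fin_succ, hI hiI, hI hjI, hI hkI])
  rw [Matrix.det_fin_three] at hdet
  simp only [Matrix.of_apply, Matrix.cons_val_zero, Matrix.cons_val_one, Matrix.cons_val, ai, bj, ck]
    at hdet
  -- the determinant is `a_j b_k c_i + a_k b_i c_j`, and both terms are equal
  have h4 : u a j * u b k * u c i = u a k * u b i * u c j := by
    have hpp : u p i * u p j * u p k ≠ 0 := by
      refine mul_ne_zero (mul_ne_zero ?_ ?_) ?_ <;> rw [← abs_pos] <;> simp [pi, pj, pk]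
    apply mul_left_cancel₀ hpp
    linear_combination -(u p i * u b k * (u p j * u c i)) * e1 +
      u p j * u a k * (u p j * u c i) * e2 - u p j * u a k * (u p k * u b i) * e3
  have h5 : |u a j * u b k * u c i| = 1 := by simp [abs_mul, aj, bk, ci]
  have h6 : |2 * (u a j * u b k * u c i)| ≤ 1 := by
    refine le_trans (le_of_eq ?_) hdet
    congr 1
    linear_combination h4
  rw [abs_mul, h5] at h6
  norm_num at h6

theorem _root_.Matrix.det_ite_add {R : Type*} [CommRing R] {k : ℕ} (g : Fin k → R) :
    (Matrix.of fun a c : Fin k => (if a = c then 1 else 0) + g c).det = 1 + ∑ c, g c := by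
  have h := Matrix.det_one_add_replicateCol_mul_replicateRow (ι := Unit) (fun _ : Fin k => (1 : R)) g
  have h2 : (1 + Matrix.replicateCol Unit (fun _ : Fin k => (1 : R)) *
      Matrix.replicateRow Unit g) =
      Matrix.of fun a c : Fin k => (if a = c then 1 else 0) + g c := by
    ext a c
    simp [Matrix.mul_apply, Matrix.one_apply]
  rw [← h2, h]
  simp [dotProduct]

/-- The sign patterns of vectors with given nonzero fractional parts shatter no set of size five:
with fractional parts `f`, the two `5 × 5` patterns with one exceptional entry in each row have the
determinants `∑ f - 1` and `∑ f - 4`, which are not both in the interval from `-1` to `1`. -/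
theorem not_shatters_five [DecidableEq ι] (h : MinorsLeOne u F S) {J : Finset ι} (hJ : J ⊆ S)
    (f : ι → ℝ) (hf : ∀ e ∈ F, ∀ i ∈ J, (0 < u e i → u e i = f i) ∧
      (¬ 0 < u e i → u e i = f i - 1)) {s : Finset ι} (hs : s ⊆ J) (hcard : s.card = 5) :
    ¬ (F.image fun e => {i ∈ J | 0 < u e i}).Shatters s := by
  classical
  intro hsh
  let i : Fin 5 → ι := fun c => (s.equivFinOfCardEq hcard).symm c
  have hi : Function.Injective i :=
    Subtype.val_injective.comp (s.equivFinOfCardEq hcard).symm.injective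
  have his : ∀ c, i c ∈ s := fun c => ((s.equivFinOfCardEq hcard).symm c).2
  have key : ∀ p : Fin 5 → Fin 5 → Prop, ∃ e : Fin 5 → α, (∀ a, e a ∈ F) ∧
      ∀ a c, u (e a) (i c) = f (i c) - if p a c then 0 else 1 := by
    intro p
    have hex : ∀ a, ∃ e ∈ F, ∀ c, u e (i c) = f (i c) - if p a c then 0 else 1 := by
      intro a
      obtain ⟨v, hv, hvt⟩ := hsh (t := (Finset.univ.filter (p a)).image i) (by
        intro l hl
        obtain ⟨c, -, rfl⟩ := Finset.mem_image.1 hl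
        exact his c)
      obtain ⟨e, he, rfl⟩ := Finset.mem_image.1 hv
      refine ⟨e, he, fun c => ?_⟩
      have hpc : p a c ↔ 0 < u e (i c) := by
        have h1 : i c ∈ s ∩ {l ∈ J | 0 < u e l} ↔ i c ∈ (Finset.univ.filter (p a)).image i := by
          rw [hvt]
        rw [Finset.mem_inter, and_iff_right (his c), Finset.mem_filter,
          and_iff_right (hs (his c)), Finset.mem_image] at h1
        rw [h1]
        refine ⟨fun hp => ⟨c, by simpa using hp, rfl⟩, ?_⟩
        rintro ⟨c', hc', hcc⟩
        rw [hi hcc] at hc'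
        simpa using hc'
      by_cases hp : p a c
      · simp [hp, (hf e he _ (hs (his c))).1 (hpc.1 hp)]
      · simp [hp, (hf e he _ (hs (his c))).2 fun hu => hp (hpc.2 hu)]
    choose e he hue using hex
    exact ⟨e, he, hue⟩
  obtain ⟨e₁, he₁, hu₁⟩ := key fun a c => a = c
  obtain ⟨e₂, he₂, hu₂⟩ := key fun a c => a ≠ c
  have h1 := h 5 e₁ i he₁ hi fun c => hJ (hs (his c))
  have h2 := h 5 e₂ i he₂ hi fun c => hJ (hs (his c))
  have m1 : (Matrix.of fun a c => u (e₁ a) (i c)) =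
      Matrix.of fun a c : Fin 5 => (if a = c then 1 else 0) + (f (i c) - 1) := by
    ext a c
    rw [Matrix.of_apply, Matrix.of_apply, hu₁]
    split_ifs <;> ring
  have m2 : (Matrix.of fun a c => u (e₂ a) (i c)) =
      -Matrix.of fun a c : Fin 5 => (if a = c then 1 else 0) + (-f (i c)) := by
    ext a c
    rw [Matrix.of_apply, Matrix.neg_apply, Matrix.of_apply, hu₂]
    by_cases hac : a = c
    · simp [hac, sub_eq_add_neg]
    · simp [hac]
  rw [m1, Matrix.det_ite_add, abs_le] at h1
  rw [m2, Matrix.det_neg, Matrix.det_ite_add, abs_le] at h2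
  simp only [Finset.sum_sub_distrib, Finset.sum_neg_distrib, Finset.sum_const, Finset.card_univ,
    Fintype.card_fin] at h1 h2
  norm_num at h1 h2
  linarith [h1.1, h2.2]

/-- The number of vectors with minors at most one in a class modulo the integer vectors. The common
fractional parts split `S` into integral and other coordinates, and a vector is determined by the
support of its integral coordinates and the signs of the other ones. The function `pick` normalizes
the sign of each vector: in a nonempty set of coordinates `±1`, the picked one is `1`. -/
theorem card_class_le [DecidableEq ι] (h : MinorsLeOne u F S)
    (hclass : ∀ e ∈ F, ∀ f ∈ F, ∀ i ∈ S, ∃ z : ℤ, u e i - u f i = z)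
    (pick : Finset ι → ι) (hpick : ∀ e ∈ F, ({i ∈ S | |u e i| = 1}).Nonempty →
      pick {i ∈ S | |u e i| = 1} ∈ ({i ∈ S | |u e i| = 1} : Finset ι) ∧
        u e (pick {i ∈ S | |u e i| = 1}) = 1)
    (hinj : ∀ e ∈ F, ∀ f ∈ F, (∀ i ∈ S, u e i = u f i) → e = f) :
    ∃ a b, a + b = S.card ∧
      F.card ≤ (∑ j ∈ Finset.range 3, a.choose j) * ∑ j ∈ Finset.range 5, b.choose j := by
  classical
  rcases F.eq_empty_or_nonempty with rfl | ⟨e₀, he₀⟩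
  · exact ⟨S.card, 0, rfl, by simp⟩
  -- the coordinates that are integral, and those that are not, for all vectors in the class
  set I : Finset ι := {i ∈ S | ∃ z : ℤ, u e₀ i = z} with hI
  set J : Finset ι := {i ∈ S | ¬ ∃ z : ℤ, u e₀ i = z} with hJ
  have hIS : I ⊆ S := Finset.filter_subset _ _
  have hJS : J ⊆ S := Finset.filter_subset _ _
  have hint : ∀ e ∈ F, ∀ i ∈ S, (∃ z : ℤ, u e i = z) → i ∈ I := by
    rintro e he i hi ⟨z, hz⟩
    obtain ⟨y, hy⟩ := hclass e he e₀ he₀ i hi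
    exact Finset.mem_filter.2 ⟨hi, z - y, by push_cast; linarith⟩
  have h01 : ∀ e ∈ F, ∀ i ∈ I, |u e i| = 1 ∨ u e i = 0 := by
    intro e he i hi
    obtain ⟨hiS, z, hz⟩ := Finset.mem_filter.1 hi
    obtain ⟨y, hy⟩ := hclass e he e₀ he₀ i hiS
    have h1 := h.abs_le_one he hiS
    have h2 : u e i = ((z + y : ℤ) : ℝ) := by push_cast; linarith
    rw [h2, ← Int.cast_abs] at h1 ⊢
    have h3 : |z + y| ≤ 1 := by exact_mod_cast h1
    have h4 : z + y = 1 ∨ z + y = 0 ∨ z + y = -1 := by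
      rw [abs_le] at h3
      omega
    rcases h4 with h4 | h4 | h4 <;> simp [h4]
  have hf : ∀ e ∈ F, ∀ i ∈ J, (0 < u e i → u e i = Int.fract (u e₀ i)) ∧
      (¬ 0 < u e i → u e i = Int.fract (u e₀ i) - 1) := by
    intro e he i hi
    have hiS := hJS hi
    have hnot : ∀ z : ℤ, u e i ≠ z := by
      intro z hz
      exact (Finset.mem_filter.1 hi).2 (Finset.mem_filter.1 (hint e he i hiS ⟨z, hz⟩)).2
    have h1 := abs_le.1 (h.abs_le_one he hiS)
    have h2 : u e i ≠ -1 := by simpa using hnot (-1)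
    have h3 : u e i ≠ 1 := by simpa using hnot 1
    have h4 : u e i ≠ 0 := by simpa using hnot 0
    obtain ⟨y, hy⟩ := hclass e₀ he₀ e he i hiS
    have h5 : Int.fract (u e₀ i) = Int.fract (u e i) := by
      rw [Int.fract_eq_fract]
      exact ⟨y, hy⟩
    rw [h5]
    refine ⟨fun hpos => ?_, fun hneg => ?_⟩
    · exact (Int.fract_eq_self.2 ⟨hpos.le, lt_of_le_of_ne h1.2 h3⟩).symm
    · have h6 : Int.fract (u e i) = Int.fract (u e i + 1) := by simp
      rw [h6, Int.fract_eq_self.2 ⟨by linarith, ?_⟩]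
      · ring
      · have := lt_of_le_of_ne (not_lt.1 hneg) h4
        linarith
  refine ⟨I.card, J.card, Finset.card_filter_add_card_filter_not _, ?_⟩
  have hB : (F.image fun e => {i ∈ S | |u e i| = 1}).card ≤
      ∑ j ∈ Finset.range 3, I.card.choose j := by
    refine Finset.card_le_sum_choose_of_not_shatters ?_ fun s hs hc =>
      h.not_shatters_three hIS h01 hs hc
    intro t ht i hi
    obtain ⟨e, he, rfl⟩ := Finset.mem_image.1 ht
    obtain ⟨hiS, h1⟩ := Finset.mem_filter.1 hi
    refine hint e he i hiS ?_
    rcases eq_or_eq_neg_of_abs_eq h1 with h1 | h1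
    · exact ⟨1, by simpa using h1⟩
    · exact ⟨-1, by simpa using h1⟩
  have hA : (F.image fun e => {i ∈ J | 0 < u e i}).card ≤
      ∑ j ∈ Finset.range 5, J.card.choose j := by
    refine Finset.card_le_sum_choose_of_not_shatters ?_ fun s hs hc =>
      h.not_shatters_five hJS (fun i => Int.fract (u e₀ i)) hf hs hc
    intro t ht
    obtain ⟨e, he, rfl⟩ := Finset.mem_image.1 ht
    exact Finset.filter_subset _ _
  refine le_trans ?_ (Nat.mul_le_mul hB hA)
  rw [← Finset.card_product]
  refine Finset.card_le_card_of_injOn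
    (fun e => ({i ∈ S | |u e i| = 1}, {i ∈ J | 0 < u e i})) ?_ ?_
  · intro e he
    exact Finset.mem_coe.2 (Finset.mem_product.2
      ⟨Finset.mem_image_of_mem _ he, Finset.mem_image_of_mem _ he⟩)
  · intro e he f hf' hef
    rw [Finset.mem_coe] at he hf'
    obtain ⟨hB', hA'⟩ := Prod.mk.inj hef
    refine hinj e he f hf' fun i hi => ?_
    by_cases hiI : ∃ z : ℤ, u e₀ i = z
    · have hiI' : i ∈ I := Finset.mem_filter.2 ⟨hi, hiI⟩
      by_cases hei : |u e i| = 1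
      · have hmem : i ∈ ({i ∈ S | |u e i| = 1} : Finset ι) := Finset.mem_filter.2 ⟨hi, hei⟩
        have hfi : |u f i| = 1 := by
          rw [hB'] at hmem
          exact (Finset.mem_filter.1 hmem).2
        obtain ⟨hpe, hpe1⟩ := hpick e he ⟨i, hmem⟩
        obtain ⟨-, hpf1⟩ := hpick f hf' (hB' ▸ ⟨i, hmem⟩)
        rw [← hB'] at hpf1
        generalize pick {i ∈ S | |u e i| = 1} = p at hpe hpe1 hpf1
        by_cases hip : p = i
        · rw [← hip, hpe1, hpf1]
        · have := h.mul_eq_mul he hf' (Finset.mem_filter.1 hpe).1 hi hip (by simp [hpe1]) hei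
            (by simp [hpf1]) hfi
          rw [hpe1, hpf1] at this
          linarith
      · have hfi : ¬ |u f i| = 1 := by
          intro hfi
          have hmem : i ∈ ({i ∈ S | |u f i| = 1} : Finset ι) := Finset.mem_filter.2 ⟨hi, hfi⟩
          rw [← hB'] at hmem
          exact hei (Finset.mem_filter.1 hmem).2
        rw [(h01 e he i hiI').resolve_left hei, (h01 f hf' i hiI').resolve_left hfi]
    · have hiJ : i ∈ J := Finset.mem_filter.2 ⟨hi, hiI⟩
      have hiff : 0 < u e i ↔ 0 < u f i := by
        have : i ∈ ({i ∈ J | 0 < u e i} : Finset ι) ↔ i ∈ ({i ∈ J | 0 < u f i} : Finset ι) := by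
          rw [hA']
        simpa [hiJ] using this
      by_cases hpos : 0 < u e i
      · rw [(hf e he i hiJ).1 hpos, (hf f hf' i hiJ).1 (hiff.1 hpos)]
      · rw [(hf e he i hiJ).2 hpos, (hf f hf' i hiJ).2 fun h => hpos (hiff.2 h)]

end MinorsLeOne

/-! ### Counting the columns of an integer matrix -/

/-- Cramer's rule for minors: if `u e` are the coordinates of `v e` with respect to the basis
`v (h i)`, then each minor of the coordinate vectors is a quotient of two determinants of the `v`,
where the elements `e` replace those at the positions `i`. -/
theorem Matrix.det_minor_mul_det {ι α : Type*} [Fintype ι] [DecidableEq ι]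
    (v : α → ι → ℝ) (u : α → ι → ℝ) (h : ι → α)
    (huv : ∀ e, (fun k => ∑ i, u e i * v (h i) k) = v e)
    (hh : (Matrix.of fun i => v (h i)).det ≠ 0)
    {k : ℕ} (e : Fin k → α) (i : Fin k → ι) (hi : Function.Injective i) :
    (Matrix.of fun a c => u (e a) (i c)).det * (Matrix.of fun l => v (h l)).det =
      (Matrix.of fun l => v (Function.extend i e h l)).det := by
  classical
  have huh : ∀ l, u (h l) = Pi.single l 1 := by
    intro l
    have h1 := huv (h l)
    have hinj := Matrix.vecMul_injective_of_isUnit ((Matrix.isUnit_iff_isUnit_det _).2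
      (isUnit_iff_ne_zero.2 hh))
    apply hinj
    ext k
    have h2 := congrFun h1 k
    simp only [Matrix.vecMul, dotProduct, Matrix.of_apply]
    rw [h2]
    simp [Pi.single_apply]
  have hmul : (Matrix.of fun l => v (Function.extend i e h l)) =
      (Matrix.of fun l => u (Function.extend i e h l)) * Matrix.of fun l => v (h l) := by
    ext l k
    rw [Matrix.mul_apply]
    exact (congrFun (huv _) k).symm
  rw [hmul, Matrix.det_mul]
  congr 1
  rw [Matrix.twoBlockTriangular_det _ (fun l => l ∈ Set.range i)]
  · have h1 : (Matrix.toSquareBlockProp (Matrix.of fun l => u (Function.extend i e h l))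
        (fun l => ¬ l ∈ Set.range i)) = 1 := by
      ext a b
      have ha : ¬ ∃ x, i x = a.1 := a.2
      change u (Function.extend i e h a.1) b.1 = _
      rw [Function.extend_apply' _ _ _ ha, huh]
      simp [Matrix.one_apply, Pi.single_apply, Subtype.ext_iff, eq_comm]
    have h2 := Matrix.det_submatrix_equiv_self (Equiv.ofInjective i hi)
      (Matrix.toSquareBlockProp (Matrix.of fun l => u (Function.extend i e h l))
        fun l => l ∈ Set.range i)
    have h3 : (Matrix.toSquareBlockProp (Matrix.of fun l => u (Function.extend i e h l))
        fun l => l ∈ Set.range i).submatrix (Equiv.ofInjective i hi) (Equiv.ofInjective i hi) =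
        Matrix.of fun a c => u (e a) (i c) := by
      ext a c
      simp [Matrix.toSquareBlockProp, hi.extend_apply]
    rw [h3] at h2
    rw [h1, Matrix.det_one, mul_one]
    convert h2
  · intro a ha b hb
    have ha' : ¬ ∃ x, i x = a := ha
    have hab : b ≠ a := fun h => ha (h ▸ hb)
    simp [Function.extend_apply' _ _ _ ha', huh, hab]

/-- The index of the lattice spanned by the rows of an integer matrix. -/
theorem Matrix.card_quotient_range_vecMulLinear {ι : Type*} [Fintype ι] [DecidableEq ι]
    (A : Matrix ι ι ℤ) (hA : A.det ≠ 0) :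
    Nat.card ((ι → ℤ) ⧸ LinearMap.range A.vecMulLinear) = A.det.natAbs := by
  have hinj : Function.Injective A.vecMulLinear := by
    intro x y hxy
    have h1 : Matrix.vecMul x A = Matrix.vecMul y A := hxy
    have h2 := congrArg (fun z => Matrix.vecMul z A.adjugate) h1
    simp only [Matrix.vecMul_vecMul, Matrix.mul_adjugate, Matrix.vecMul_smul, Matrix.vecMul_one]
      at h2
    exact smul_right_injective _ hA h2
  rw [← Submodule.natAbs_det_equiv _ (LinearEquiv.ofInjective A.vecMulLinear hinj)]
  have : (LinearMap.range A.vecMulLinear).subtype ∘ₗ AddMonoidHom.toIntLinearMap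
      ((LinearEquiv.ofInjective A.vecMulLinear hinj : (ι → ℤ) ≃ₗ[ℤ] _) :
        (ι → ℤ) →+ LinearMap.range A.vecMulLinear) = Matrix.toLin' A.transpose := by
    ext x y
    simp [Matrix.vecMul]
  rw [this, LinearMap.det_toLin', Matrix.det_transpose]

/-- The number of integer vectors in the span of `S.card` given vectors, such that no two of them
agree up to sign, in terms of a bound `Δ` for their determinants. The coordinates with respect to a
choice of elements with maximal determinant have minors at most one. The integer vectors fall into
at most `Δ` classes modulo the lattice that this choice generates. -/
theorem card_le_of_abs_det_le {ι α : Type*} [Fintype ι] [DecidableEq ι] [Nonempty ι] (v : α → ι → ℤ)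
    (E : Set α) (Δ N : ℕ)
    (hdet : ∀ h : ι → α, (∀ i, h i ∈ E) → |(Matrix.of fun i => v (h i)).det| ≤ Δ)
    (b : ι → α) (hb : ∀ i, b i ∈ E) (hb0 : (Matrix.of fun i => v (b i)).det ≠ 0)
    (S : Finset ι) (F : Finset α) (hFE : ∀ e ∈ F, e ∈ E)
    (hspan : ∀ e ∈ F, ∃ c : ι → ℝ, (∀ i ∉ S, c i = 0) ∧
      ∀ k, (v e k : ℝ) = ∑ i, c i * v (b i) k)
    (hne : ∀ e ∈ F, ∀ f ∈ F, v e = v f ∨ v e = -v f → e = f)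
    (hN : ∀ a b, a + b = S.card →
      (∑ j ∈ Finset.range 3, a.choose j) * (∑ j ∈ Finset.range 5, b.choose j) ≤ N) :
    F.card ≤ N * Δ := by
  classical
  -- a choice of elements that span the same space as `b i`, for `i ∈ S`, with maximal determinant
  let Sp : α → Prop := fun e => ∃ c : ι → ℝ, (∀ i ∉ S, c i = 0) ∧
    ∀ k, (v e k : ℝ) = ∑ i, c i * v (b i) k
  let Cand : (ι → α) → Prop := fun h => (∀ i, h i ∈ E) ∧ (∀ i ∉ S, h i = b i) ∧
    ∀ i ∈ S, Sp (h i)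
  have hbC : Cand b := by
    refine ⟨hb, fun _ _ => rfl, fun i hi => ⟨Pi.single i 1, fun j hj => ?_, fun k => ?_⟩⟩
    · have : j ≠ i := fun h => hj (h ▸ hi)
      simp [this]
    · simp [Pi.single_apply]
  let P : ℕ → Prop := fun q => ∃ h, Cand h ∧ (Matrix.of fun i => v (h i)).det.natAbs = q
  have hPle : ∀ q, P q → q ≤ Δ := by
    rintro q ⟨h, hh, rfl⟩
    have := hdet h hh.1
    rw [Int.abs_eq_natAbs] at this
    exact_mod_cast this
  have hPb : P (Matrix.of fun i => v (b i)).det.natAbs := ⟨b, hbC, rfl⟩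
  obtain ⟨h, hh, hq⟩ : P (Nat.findGreatest P Δ) := Nat.findGreatest_spec (hPle _ hPb) hPb
  have hmax : ∀ h', Cand h' → (Matrix.of fun i => v (h' i)).det.natAbs ≤
      (Matrix.of fun i => v (h i)).det.natAbs := by
    intro h' hh'
    rw [hq]
    exact Nat.le_findGreatest (hPle _ ⟨h', hh', rfl⟩) ⟨h', hh', rfl⟩
  have hA0 : (Matrix.of fun i => v (h i)).det ≠ 0 := by
    have h1 := hmax b hbC
    intro h0
    rw [h0] at h1
    simp at h1
    exact hb0 h1
  set A : Matrix ι ι ℤ := Matrix.of fun i => v (h i) with hAdef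
  let w : α → ι → ℝ := fun e k => (v e k : ℝ)
  have hcast : ∀ h : ι → α, (Matrix.of fun i => w (h i)).det =
      (((Matrix.of fun i => v (h i)).det : ℤ) : ℝ) := by
    intro h
    rw [Int.cast_det]
    rfl
  have hAw : (Matrix.of fun i => w (h i)).det ≠ 0 := by
    rw [hcast]
    exact_mod_cast hA0
  set Aw : Matrix ι ι ℝ := Matrix.of fun i => w (h i) with hAw'
  have hAwu : IsUnit Aw.det := isUnit_iff_ne_zero.2 hAw
  let u : α → ι → ℝ := fun e => Matrix.vecMul (w e) Aw⁻¹
  have huA : ∀ e, Matrix.vecMul (u e) Aw = w e := by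
    intro e
    rw [Matrix.vecMul_vecMul, Matrix.nonsing_inv_mul _ hAwu, Matrix.vecMul_one]
  have huv : ∀ e, (fun k => ∑ i, u e i * w (h i) k) = w e := by
    intro e
    rw [← huA e]
    rfl
  have hAinj := Matrix.vecMul_injective_of_isUnit ((Matrix.isUnit_iff_isUnit_det _).2 hAwu)
  have hsupp : ∀ e, Sp e → ∀ i ∉ S, u e i = 0 := by
    rintro e ⟨c, hc, hce⟩ i hi
    -- the coordinates of the chosen elements with respect to `b`
    have hex : ∀ l, ∃ x : ι → ℝ, (l ∈ S → ∀ i ∉ S, x i = 0) ∧ (l ∉ S → x = Pi.single l 1) ∧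
        ∀ k, w (h l) k = ∑ i, x i * w (b i) k := by
      intro l
      by_cases hl : l ∈ S
      · obtain ⟨x, hx, hx'⟩ := hh.2.2 l hl
        exact ⟨x, fun _ => hx, fun h => absurd hl h, hx'⟩
      · refine ⟨Pi.single l 1, fun h => absurd h hl, fun _ => rfl, fun k => ?_⟩
        rw [hh.2.1 l hl]
        simp [Pi.single_apply]
    choose x hx1 hx2 hx3 using hex
    have hB : IsUnit (Matrix.of fun i => w (b i)) := by
      rw [Matrix.isUnit_iff_isUnit_det, hcast]
      exact isUnit_iff_ne_zero.2 (by exact_mod_cast hb0)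
    have hAB : Aw = Matrix.of x * Matrix.of fun i => w (b i) := by
      ext l k
      rw [Matrix.mul_apply]
      exact hx3 l k
    have hcu : Matrix.vecMul (u e) (Matrix.of x) = c := by
      apply Matrix.vecMul_injective_of_isUnit hB
      change Matrix.vecMul (Matrix.vecMul (u e) (Matrix.of x)) _ = Matrix.vecMul c _
      rw [Matrix.vecMul_vecMul, ← hAB, huA]
      ext k
      exact hce k
    have h1 := congrFun hcu i
    rw [hc i hi] at h1
    rw [← h1, Matrix.vecMul, dotProduct, Finset.sum_eq_single i]
    · simp [hx2 i hi]
    · intro l _ hl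
      by_cases hlS : l ∈ S
      · simp [hx1 l hlS i hi]
      · simp [hx2 l hlS, hl.symm]
    · simp
  have hminor : MinorsLeOne u F S := by
    intro k e i he hi hiS
    have h1 := Matrix.det_minor_mul_det w u h huv hAw e i hi
    have hC : Cand (Function.extend i e h) := by
      have hcases : ∀ l, (∃ a, i a = l ∧ Function.extend i e h l = e a) ∨
          ((¬ ∃ a, i a = l) ∧ Function.extend i e h l = h l) := by
        intro l
        by_cases hl : ∃ a, i a = l
        · obtain ⟨a, rfl⟩ := hl
          exact Or.inl ⟨a, rfl, hi.extend_apply _ _ _⟩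
        · exact Or.inr ⟨hl, Function.extend_apply' _ _ _ hl⟩
      refine ⟨fun l => ?_, fun l hl => ?_, fun l hl => ?_⟩
      · rcases hcases l with ⟨a, -, ha⟩ | ⟨-, ha⟩ <;> rw [ha]
        · exact hFE _ (he a)
        · exact hh.1 l
      · rcases hcases l with ⟨a, hal, -⟩ | ⟨-, ha⟩
        · exact absurd (hal ▸ hiS a) hl
        · rw [ha, hh.2.1 l hl]
      · rcases hcases l with ⟨a, -, ha⟩ | ⟨-, ha⟩ <;> rw [ha]
        · exact hspan _ (he a)
        · exact hh.2.2 l hl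
    have h2 := hmax _ hC
    have h3 : |(Matrix.of fun l => w (Function.extend i e h l)).det| ≤ |Aw.det| := by
      rw [hAw', hcast, hcast, ← Int.cast_abs, ← Int.cast_abs, Int.abs_eq_natAbs, Int.abs_eq_natAbs]
      exact_mod_cast h2
    rw [← h1, abs_mul] at h3
    have h4 : 0 < |Aw.det| := abs_pos.2 hAw
    exact le_of_mul_le_mul_right (by rw [one_mul]; exact h3) h4
  -- the signs for which the first coordinate `±1`, if there is any, is positive
  let pick : Finset ι → ι := fun T => if hT : T.Nonempty then hT.choose else Classical.arbitrary ι
  have hpick : ∀ T : Finset ι, T.Nonempty → pick T ∈ T := by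
    intro T hT
    simp only [pick, hT, dif_pos]
    exact hT.choose_spec
  let B : α → Finset ι := fun e => {i ∈ S | |u e i| = 1}
  let s : α → ℤ := fun e => if u e (pick (B e)) = -1 then -1 else 1
  have hs : ∀ e, s e = 1 ∨ s e = -1 := fun e => by
    simp only [s]
    split_ifs <;> simp
  have hsabs : ∀ e, |(s e : ℝ)| = 1 := fun e => by rcases hs e with h | h <;> simp [h]
  let u' : α → ι → ℝ := fun e i => s e * u e i
  have hu'abs : ∀ e i, |u' e i| = |u e i| := fun e i => by
    simp only [u', abs_mul, hsabs, one_mul]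
  have hB : ∀ e, ({i ∈ S | |u' e i| = 1} : Finset ι) = B e := fun e => by
    simp only [hu'abs, B]
  have hminor' : MinorsLeOne u' F S := by
    intro k e i he hi hiS
    have h1 := Matrix.det_mul_column (fun a => (s (e a) : ℝ)) (Matrix.of fun a c => u (e a) (i c))
    have h2 : (Matrix.of fun a c => u' (e a) (i c)) = Matrix.of fun a c =>
      (s (e a) : ℝ) * (Matrix.of fun a c => u (e a) (i c)) a c := rfl
    rw [h2, h1, abs_mul, Finset.abs_prod]
    simp only [hsabs, Finset.prod_const_one, one_mul]
    exact hminor k e i he hi hiS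
  have hu'A : ∀ e, Matrix.vecMul (u' e) Aw = fun k => (s e : ℝ) * w e k := by
    intro e
    have : u' e = (s e : ℝ) • u e := rfl
    rw [this, Matrix.smul_vecMul, huA]
    rfl
  let κ : α → (ι → ℤ) ⧸ LinearMap.range A.vecMulLinear := fun e => Submodule.Quotient.mk (s e • v e)
  have hκ : ∀ e f, κ e = κ f → ∀ i, ∃ z : ℤ, u' e i - u' f i = z := by
    intro e f hef
    obtain ⟨n, hn⟩ := (Submodule.Quotient.eq _).1 hef
    have h1 : u' e - u' f = fun i => (n i : ℝ) := by
      apply hAinj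
      change Matrix.vecMul (u' e - u' f) Aw = Matrix.vecMul (fun i => (n i : ℝ)) Aw
      rw [Matrix.sub_vecMul, hu'A, hu'A]
      ext k
      have h2 := congrFun hn k
      rw [Matrix.vecMulLinear_apply] at h2
      have h3 : ((Matrix.vecMul n A k : ℤ) : ℝ) = (((s e • v e - s f • v f) k : ℤ) : ℝ) := by
        rw [h2]
      simp only [Matrix.vecMul, dotProduct, hAdef, Matrix.of_apply, Pi.sub_apply, Pi.smul_apply,
        smul_eq_mul] at h3
      push_cast at h3
      simp only [Matrix.vecMul, dotProduct, hAw', Matrix.of_apply, Pi.sub_apply, w]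
      exact h3.symm
    exact fun i => ⟨n i, congrFun h1 i⟩
  have hcardQ := Matrix.card_quotient_range_vecMulLinear A hA0
  have hQ0 : Nat.card ((ι → ℤ) ⧸ LinearMap.range A.vecMulLinear) ≠ 0 := by
    rw [hcardQ]
    exact Int.natAbs_ne_zero.2 hA0
  have hfin : Finite ((ι → ℤ) ⧸ LinearMap.range A.vecMulLinear) := Nat.finite_of_card_ne_zero hQ0
  have hfib : F.card ≤ N * (F.image κ).card := by
    refine Finset.card_le_mul_card_image F N fun a _ => ?_
    have hsub : {e ∈ F | κ e = a} ⊆ F := Finset.filter_subset _ _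
    obtain ⟨x, y, hxy, hle⟩ := (hminor'.mono hsub).card_class_le
      (fun e he f hf i _ => hκ e f
        ((Finset.mem_filter.1 he).2.trans (Finset.mem_filter.1 hf).2.symm) i)
      pick (fun e he hne => by
        rw [hB] at hne ⊢
        have hp := hpick _ hne
        refine ⟨hp, ?_⟩
        have h1 : |u e (pick (B e))| = 1 := (Finset.mem_filter.1 hp).2
        simp only [u', s]
        split_ifs with h2
        · simp [h2]
        · simpa using (eq_or_eq_neg_of_abs_eq h1).resolve_right h2)
      (fun e he f hf hef => by
        have heF := hsub he
        have hfF := hsub hf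
        have h1 : u' e = u' f := by
          ext i
          by_cases hi : i ∈ S
          · exact hef i hi
          · simp [u', hsupp e (hspan e heF) i hi, hsupp f (hspan f hfF) i hi]
        have h2 := hu'A e
        rw [h1, hu'A f] at h2
        have h3 : ∀ k, s f * v f k = s e * v e k := fun k => by
          have := congrFun h2 k
          simp only [w] at this
          exact_mod_cast this
        refine hne e heF f hfF ?_
        rcases hs e with he1 | he1 <;> rcases hs f with hf1 | hf1 <;> rw [he1, hf1] at h3
        · left; ext k; linarith [h3 k]
        · right; ext k; rw [Pi.neg_apply]; linarith [h3 k]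
        · right; ext k; rw [Pi.neg_apply]; linarith [h3 k]
        · left; ext k; linarith [h3 k])
    exact hle.trans (hN x y hxy)
  refine hfib.trans (Nat.mul_le_mul_left N ?_)
  have := Fintype.ofFinite ((ι → ℤ) ⧸ LinearMap.range A.vecMulLinear)
  refine (Finset.card_le_univ _).trans ?_
  rw [← Nat.card_eq_fintype_card, hcardQ]
  exact hPle _ ⟨h, hh, rfl⟩

theorem two_mul_sum_choose (a : ℕ) :
    2 * ∑ j ∈ Finset.range 3, (a.choose j : ℤ) = a ^ 2 + a + 2 := by
  induction a with
  | zero => simp [Finset.sum_range_succ]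
  | succ a ih =>
    simp only [Finset.sum_range_succ, Finset.sum_range_zero, Nat.choose_zero_right,
      Nat.choose_succ_succ, Nat.choose_one_right] at ih ⊢
    push_cast at ih ⊢
    linarith

theorem six_mul_sum_choose (b : ℕ) :
    6 * ∑ j ∈ Finset.range 4, (b.choose j : ℤ) = b ^ 3 + 5 * b + 6 := by
  induction b with
  | zero => simp [Finset.sum_range_succ]
  | succ b ih =>
    have h := two_mul_sum_choose b
    simp only [Finset.sum_range_succ, Finset.sum_range_zero, Nat.choose_zero_right,
      Nat.choose_succ_succ, Nat.choose_one_right] at ih h ⊢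
    push_cast at ih h ⊢
    linarith

theorem twentyFour_mul_sum_choose (b : ℕ) :
    24 * ∑ j ∈ Finset.range 5, (b.choose j : ℤ) =
      b ^ 4 - 2 * b ^ 3 + 11 * b ^ 2 + 14 * b + 24 := by
  induction b with
  | zero => simp [Finset.sum_range_succ]
  | succ b ih =>
    have h := six_mul_sum_choose b
    simp only [Finset.sum_range_succ, Finset.sum_range_zero, Nat.choose_zero_right,
      Nat.choose_succ_succ, Nat.choose_one_right] at ih h ⊢
    push_cast at ih h ⊢
    linarith

/-- The number of pairs of patterns in a class, for vectors in the span of at most `6 * Δ + 1`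
vectors. -/
theorem sum_choose_mul_sum_choose_le {Δ n : ℕ} (hΔ : 0 < Δ) (hn : n ≤ 6 * Δ + 1)
    (hn1 : Δ = 1 → n ≤ 1) (a b : ℕ) (hab : a + b = n) :
    (∑ j ∈ Finset.range 3, a.choose j) * (∑ j ∈ Finset.range 5, b.choose j) ≤ 66 * Δ ^ 6 := by
  have ha := two_mul_sum_choose a
  have hb := twentyFour_mul_sum_choose b
  suffices h : ((a : ℤ) ^ 2 + a + 2) * (b ^ 4 - 2 * b ^ 3 + 11 * b ^ 2 + 14 * b + 24) ≤
      48 * (66 * Δ ^ 6) by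
    rw [← ha, ← hb] at h
    have h2 : ((∑ j ∈ Finset.range 3, a.choose j : ℕ) : ℤ) *
        (∑ j ∈ Finset.range 5, b.choose j : ℕ) ≤ 66 * Δ ^ 6 := by
      push_cast
      linarith
    exact_mod_cast h2
  -- for `Δ ≤ 3` the inequality is a finite computation, with the negative terms on the right
  have hsmall : ∀ a < 20, ∀ b < 20,
      (a + b ≤ 1 → (a ^ 2 + a + 2) * (b ^ 4 + 11 * b ^ 2 + 14 * b + 24) ≤
        48 * (66 * 1 ^ 6) + (a ^ 2 + a + 2) * (2 * b ^ 3)) ∧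
      (a + b ≤ 13 → (a ^ 2 + a + 2) * (b ^ 4 + 11 * b ^ 2 + 14 * b + 24) ≤
        48 * (66 * 2 ^ 6) + (a ^ 2 + a + 2) * (2 * b ^ 3)) ∧
      (a + b ≤ 19 → (a ^ 2 + a + 2) * (b ^ 4 + 11 * b ^ 2 + 14 * b + 24) ≤
        48 * (66 * 3 ^ 6) + (a ^ 2 + a + 2) * (2 * b ^ 3)) := by
    decide +kernel
  rcases Nat.lt_or_ge Δ 4 with h4 | h4
  · have hsm := hsmall a (by omega) b (by omega)
    interval_cases Δ
    · have := hsm.1 (by have := hn1 rfl; omega)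
      zify at this
      push_cast
      linarith
    · have := hsm.2.1 (by omega)
      zify at this
      push_cast
      linarith
    · have := hsm.2.2 (by omega)
      zify at this
      push_cast
      linarith
  -- for `Δ ≥ 4` the polynomials are compared with powers of linear ones
  have hreal : ((a : ℝ) ^ 2 + a + 2) * (b ^ 4 - 2 * b ^ 3 + 11 * b ^ 2 + 14 * b + 24) ≤
      48 * (66 * Δ ^ 6) := by
    have ha0 : (0 : ℝ) ≤ a := Nat.cast_nonneg a
    have hb0 : (0 : ℝ) ≤ b := Nat.cast_nonneg b
    have hD : (4 : ℝ) ≤ Δ := by exact_mod_cast h4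
    have hab' : (a : ℝ) + b ≤ 6 * Δ + 1 := by
      rw [← hab] at hn
      exact_mod_cast hn
    set x : ℝ := a + 3 / 2 with hx
    set y : ℝ := (b + 9 / 4) / 2 with hy
    have hx0 : 0 ≤ x := by positivity
    have hy0 : 0 ≤ y := by positivity
    have h1 : (a : ℝ) ^ 2 + a + 2 ≤ x ^ 2 := by rw [hx]; nlinarith
    have h2 : (b : ℝ) ^ 4 - 2 * b ^ 3 + 11 * b ^ 2 + 14 * b + 24 ≤ 16 * y ^ 4 := by
      have h3 : 0 ≤ (b : ℝ) ^ 3 := by positivity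
      have h4 : 16 * y ^ 4 = b ^ 4 + 9 * b ^ 3 + (243 / 8) * b ^ 2 + (729 / 16) * b + 6561 / 256 := by
        rw [hy]; ring
      rw [h4]
      nlinarith
    have h3 : 0 ≤ (b : ℝ) ^ 4 - 2 * b ^ 3 + 11 * b ^ 2 + 14 * b + 24 := by
      nlinarith [sq_nonneg ((b : ℝ) ^ 2 - b)]
    have hamgm : x * y ^ 2 ≤ ((x + 2 * y) / 3) ^ 3 := by
      have : ((x + 2 * y) / 3) ^ 3 - x * y ^ 2 = (x - y) ^ 2 * (x + 8 * y) / 27 := by ring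
      have : 0 ≤ (x - y) ^ 2 * (x + 8 * y) / 27 := by positivity
      linarith
    have hle : (x + 2 * y) / 3 ≤ 115 / 48 * Δ := by
      rw [hx, hy]
      linarith
    have h5 : x * y ^ 2 ≤ (115 / 48 * Δ) ^ 3 :=
      hamgm.trans (pow_le_pow_left₀ (by positivity) hle 3)
    calc _ ≤ x ^ 2 * (16 * y ^ 4) := mul_le_mul h1 h2 h3 (by positivity)
      _ = 16 * (x * y ^ 2) ^ 2 := by ring
      _ ≤ 16 * ((115 / 48 * Δ) ^ 3) ^ 2 := by
        have := pow_le_pow_left₀ (by positivity) h5 2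
        linarith
      _ = 16 * (115 / 48) ^ 6 * Δ ^ 6 := by ring
      _ ≤ 48 * (66 * Δ ^ 6) := by
        have : (0 : ℝ) ≤ (Δ : ℝ) ^ 6 := by positivity
        nlinarith
  exact_mod_cast hreal

/-! ### Representations by integer vectors -/

namespace Matrix

/-- Some `A.rank` rows of `A` span the row space, and restricting the columns to them keeps the
linear independence of each set of columns. -/
theorem exists_rows_linearIndepOn_col_iff {m n : ℕ} (A : Matrix (Fin m) (Fin n) ℝ) :
    ∃ f : Fin A.rank ↪ Fin m, ∀ T : Set (Fin n),
      LinearIndepOn ℝ A.col T ↔ LinearIndepOn ℝ (A.submatrix f id).col T := by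
  obtain ⟨κ, a, ha, hspan, hli⟩ := exists_linearIndependent' ℝ A.row
  have : Finite κ := Finite.of_injective a ha
  have := Fintype.ofFinite κ
  have hcard : Fintype.card κ = A.rank := by
    rw [A.rank_eq_finrank_span_row, ← hspan, finrank_span_eq_card hli]
  let s : Fin A.rank ≃ κ := (Fintype.equivFinOfCardEq hcard).symm
  refine ⟨⟨a ∘ s, ha.comp s.injective⟩, fun T => ?_⟩
  refine (LinearMap.linearIndepOn_iff_of_injOn
    (LinearMap.funLeft ℝ ℝ (a ∘ s)) (v := A.col) (s := T) ?_).symm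
  have hker : ∀ z ∈ Submodule.span ℝ (A.col '' T), LinearMap.funLeft ℝ ℝ (a ∘ s) z = 0 → z = 0 := by
    intro z hz h0
    have hz' : z ∈ LinearMap.range A.mulVecLin := by
      rw [Matrix.range_mulVecLin]
      exact Submodule.span_mono (Set.image_subset_range _ _) hz
    obtain ⟨y, rfl⟩ := hz'
    have hrow : ∀ w ∈ Submodule.span ℝ (Set.range A.row), w ⬝ᵥ y = 0 := by
      rw [← hspan]
      intro w hw
      induction hw using Submodule.span_induction with
      | mem w hw =>
        obtain ⟨i, rfl⟩ := hw
        have h1 := congrFun h0 (s.symm i)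
        simp only [LinearMap.funLeft_apply, Function.comp_apply, Equiv.apply_symm_apply] at h1
        exact h1
      | zero => simp
      | add u w _ _ hu hw => rw [add_dotProduct, hu, hw, add_zero]
      | smul t w _ hw => rw [smul_dotProduct, hw, smul_zero]
    ext i
    exact hrow _ (Submodule.subset_span ⟨i, rfl⟩)
  intro z hz z' hz' h
  rw [← sub_eq_zero]
  refine hker _ (Submodule.sub_mem _ hz hz') ?_
  rw [map_sub, h, sub_self]

end Matrix

namespace Matroid

variable {α : Type*} {M : Matroid α}

/-- A `Δ`-modular matroid of rank `r` is represented by integer vectors with `r` coordinates such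
that no determinant of `r` vectors exceeds `Δ` in absolute value. -/
theorem IsDeltaModular.exists_int_vectors {r Δ : ℕ} (hM : M.IsDeltaModular Δ)
    (hrank : M.eRank = r) :
    M.E.Finite ∧ ∃ v : α → Fin r → ℤ,
      (∀ S ⊆ M.E, M.Indep S ↔ LinearIndepOn ℝ (fun e k => (v e k : ℝ)) S) ∧
      ∀ h : Fin r → α, (∀ i, h i ∈ M.E) → |(Matrix.of fun i => v (h i)).det| ≤ Δ := by
  classical
  obtain ⟨m, n, A, c, hA, hind⟩ := hM
  set R : Matrix (Fin m) (Fin n) ℝ := A.map (Int.cast : ℤ → ℝ) with hR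
  set g : Fin n → α := fun j => (c j : α) with hg
  have hginj : Function.Injective g := Subtype.val_injective.comp c.injective
  have hgimg : ∀ S ⊆ M.E, g '' (g ⁻¹' S) = S := by
    intro S hS
    refine Set.image_preimage_eq_of_subset fun e he => ⟨c.symm ⟨e, hS he⟩, by simp [hg]⟩
  have : Finite M.E := Finite.of_equiv _ c
  refine ⟨Set.toFinite _, ?_⟩
  obtain rfl : R.rank = r := by
    apply le_antisymm
    · obtain ⟨κ, a, ha, hspan, hli⟩ := exists_linearIndependent' ℝ R.col
      have : Finite κ := Finite.of_injective a ha
      have := Fintype.ofFinite κ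
      have h1 : M.Indep (g '' Set.range a) :=
        (hind _).2 ((linearIndepOn_range_iff ha _).2 hli)
      have h2 := h1.encard_le_eRank
      rw [hrank, hginj.encard_image, ← Set.image_univ, ha.encard_image, Set.encard_univ,
        ENat.card_eq_coe_fintype_card] at h2
      rw [R.rank_eq_finrank_span_cols, ← hspan, finrank_span_eq_card hli]
      exact_mod_cast h2
    · obtain ⟨B, hB⟩ := M.exists_isBase
      have h1 := (hind (g ⁻¹' B)).1 (by rw [hgimg B hB.subset_ground]; exact hB.indep)
      have h2 := hB.encard_eq_eRank
      rw [hrank, ← hgimg B hB.subset_ground, hginj.encard_image] at h2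
      have := Fintype.ofFinite (g ⁻¹' B)
      have h3 := finrank_span_eq_card h1
      rw [← Set.coe_fintypeCard] at h2
      have h4 : Fintype.card (g ⁻¹' B) = r := by exact_mod_cast h2
      rw [← h4, ← h3, R.rank_eq_finrank_span_cols]
      refine Submodule.finrank_mono (Submodule.span_mono ?_)
      rintro _ ⟨x, rfl⟩
      exact ⟨x.1, rfl⟩
  obtain ⟨f, hf⟩ := R.exists_rows_linearIndepOn_col_iff
  refine ⟨fun e k => if he : e ∈ M.E then A (f k) (c.symm ⟨e, he⟩) else 0, fun S hS => ?_,
    fun h hh => ?_⟩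
  · rw [← hgimg S hS, hind, hf]
    have hcol : (R.submatrix f id).col =
        (fun e k => (((if he : e ∈ M.E then A (f k) (c.symm ⟨e, he⟩) else 0 : ℤ)) : ℝ)) ∘ g := by
      ext j k
      simp [hg, hR, Matrix.col]
    rw [hcol]
    exact ⟨fun h => h.image_of_comp _ _, fun h => h.comp_of_image hginj.injOn⟩
  · by_cases hinj : Function.Injective h
    · have := hA f ⟨fun i => c.symm ⟨h i, hh i⟩, fun i j hij => hinj (by simpa using hij)⟩
      rw [← Matrix.det_transpose]
      convert this using 3
      ext i j
      simp [hh]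
      rfl
    · obtain ⟨i, j, hij, hne⟩ : ∃ i j, h i = h j ∧ i ≠ j := by
        simpa [Function.Injective] using hinj
      rw [Matrix.det_zero_of_row_eq hne]
      · simp
      · funext k
        simp only [Matrix.of_apply, hij]

end Matroid

/-! ### Frames of the cycle matroid of a complete graph -/

namespace Sym2

variable {V : Type*} {e₁ e₂ e₃ f₁ f₂ f₃ : Sym2 V}

/-- The three edges of a triangle. -/
def IsTriangle (e₁ e₂ e₃ : Sym2 V) : Prop :=
  ∃ c u w, c ≠ u ∧ c ≠ w ∧ u ≠ w ∧ e₁ = s(c, u) ∧ e₂ = s(c, w) ∧ e₃ = s(u, w)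

theorem IsTriangle.swap (h : IsTriangle e₁ e₂ e₃) : IsTriangle e₂ e₁ e₃ := by
  obtain ⟨c, u, w, h1, h2, h3, rfl, rfl, rfl⟩ := h
  exact ⟨c, w, u, h2, h1, h3.symm, rfl, rfl, Sym2.eq_swap⟩

theorem IsTriangle.rotate (h : IsTriangle e₁ e₂ e₃) : IsTriangle e₂ e₃ e₁ := by
  obtain ⟨c, u, w, h1, h2, h3, rfl, rfl, rfl⟩ := h
  exact ⟨w, c, u, h2.symm, h3.symm, h1, Sym2.eq_swap, Sym2.eq_swap, rfl⟩

theorem IsTriangle.unique (h : IsTriangle e₁ e₂ e₃) (h' : IsTriangle e₁ e₂ f₃) : e₃ = f₃ := by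
  obtain ⟨c, u, w, h1, h2, h3, rfl, rfl, rfl⟩ := h
  obtain ⟨c', u', w', h1', h2', h3', he1, he2, rfl⟩ := h'
  simp only [Sym2.eq_iff] at *
  grind

/-- Three edges that pairwise lie in a triangle and do not form one have a common end. The third
edges of the three triangles then join the other ends. -/
theorem IsTriangle.of_not_isTriangle (h₃ : IsTriangle e₁ e₂ f₃) (h₂ : IsTriangle e₁ e₃ f₂)
    (h₁ : IsTriangle e₂ e₃ f₁) (hne : ¬ IsTriangle e₁ e₂ e₃) : IsTriangle f₃ f₂ f₁ := by
  obtain ⟨c, u, w, h1, h2, h3, rfl, rfl, rfl⟩ := h₃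
  obtain ⟨c', u', t, h1', h2', h3', he1, rfl, rfl⟩ := h₂
  obtain ⟨c'', w'', t'', h1'', h2'', h3'', he2, he3, rfl⟩ := h₁
  have hd : ¬ s(c', t) = s(u, w) := fun h => hne ⟨c, u, w, h1, h2, h3, rfl, rfl, h⟩
  simp only [Sym2.eq_iff] at he1 he2 he3 hd
  have key : c' = c ∧ u' = u ∧ c'' = c ∧ w'' = w ∧ t'' = t ∧ t ≠ w := by grind
  obtain ⟨rfl, rfl, rfl, rfl, rfl, htw⟩ := key
  exact ⟨u', w'', t'', h3, h3', htw.symm, rfl, rfl, rfl⟩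

/-- A set of three edges contains a cycle if and only if the edges form a triangle. -/
theorem not_isAcyclic_fromEdgeSet_iff_isTriangle (h₁₂ : e₁ ≠ e₂) (h₁₃ : e₁ ≠ e₃) (h₂₃ : e₂ ≠ e₃) :
    ¬ (SimpleGraph.fromEdgeSet {e₁, e₂, e₃}).IsAcyclic ↔ IsTriangle e₁ e₂ e₃ := by
  classical
  constructor
  · intro h
    simp only [SimpleGraph.IsAcyclic, not_forall, not_not] at h
    obtain ⟨a, p, hp⟩ := h
    have hsub : p.edges.toFinset ⊆ {e₁, e₂, e₃} := by
      intro e he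
      have h1 := p.edges_subset_edgeSet (List.mem_toFinset.1 he)
      rw [SimpleGraph.edgeSet_fromEdgeSet] at h1
      simpa using h1.1
    have hcard : p.edges.toFinset.card = p.length := by
      rw [List.toFinset_card_of_nodup hp.isTrail.edges_nodup, p.length_edges]
    have h3 : ({e₁, e₂, e₃} : Finset (Sym2 V)).card = 3 := by
      rw [Finset.card_eq_three]
      exact ⟨e₁, e₂, e₃, h₁₂, h₁₃, h₂₃, rfl⟩
    have hlen : p.length = 3 :=
      le_antisymm (by rw [← hcard, ← h3]; exact Finset.card_le_card hsub) hp.three_le_length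
    have heq : p.edges.toFinset = {e₁, e₂, e₃} :=
      Finset.eq_of_subset_of_card_le hsub (by rw [hcard, hlen, h3])
    match p, hlen with
    | .cons (v := b) h₁ (.cons (v := c) h₂ (.cons (v := _) h₃ .nil)), _ =>
      have hab := h₁.ne
      have hbc := h₂.ne
      have hca := h₃.ne
      simp only [SimpleGraph.Walk.edges_cons, SimpleGraph.Walk.edges_nil, Finset.ext_iff,
        List.mem_toFinset, List.mem_cons, List.not_mem_nil, or_false, Finset.mem_insert,
        Finset.mem_singleton] at heq
      have m₁ := (heq e₁).2 (by simp)
      have m₂ := (heq e₂).2 (by simp)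
      have m₃ := (heq e₃).2 (by simp)
      have t : IsTriangle s(a, b) s(b, c) s(c, a) :=
        ⟨b, a, c, hab.symm, hbc, hca.symm, Sym2.eq_swap, rfl, Sym2.eq_swap⟩
      rcases m₁ with rfl | rfl | rfl <;> rcases m₂ with rfl | rfl | rfl <;>
        rcases m₃ with rfl | rfl | rfl <;>
        first
        | exact absurd rfl h₁₂
        | exact absurd rfl h₁₃
        | exact absurd rfl h₂₃
        | exact t
        | exact t.rotate
        | exact t.rotate.rotate
        | exact t.swap
        | exact t.rotate.swap
        | exact t.rotate.rotate.swap
  · rintro ⟨c, u, w, h1, h2, h3, rfl, rfl, rfl⟩ h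
    let G := SimpleGraph.fromEdgeSet ({s(c, u), s(c, w), s(u, w)} : Set (Sym2 V))
    have a1 : G.Adj c u := by simp [G, h1]
    have a2 : G.Adj u w := by simp [G, h3]
    have a3 : G.Adj w c := by simp [G, h2.symm, Sym2.eq_swap]
    refine h (.cons a1 (.cons a2 (.cons a3 .nil))) ?_
    rw [SimpleGraph.Walk.isCycle_def, SimpleGraph.Walk.isTrail_def]
    refine ⟨?_, by simp, ?_⟩
    · simp [h1, h2, h3, h1.symm, h2.symm]
    · simp [h3, h1.symm, h2.symm]

end Sym2

namespace Matroid

variable {α : Type*} {M : Matroid α}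

theorem IsSimple.indep_pair (hM : M.IsSimple) {e f : α} (he : e ∈ M.E) (hf : f ∈ M.E) :
    M.Indep {e, f} := by
  have hsing : ∀ x ∈ M.E, M.Indep {x} := fun x hx =>
    indep_singleton.2 (isNonloop_of_not_isLoop hx (hM.1 x))
  by_cases hef : e = f
  · subst hef
    simpa using hsing e he
  by_contra hdep
  refine hM.2 e f ⟨hef, ?_⟩
  rw [isCircuit_iff_dep_forall_sdiff_singleton_indep]
  refine ⟨⟨hdep, by simp [Set.insert_subset_iff, he, hf]⟩, ?_⟩
  rintro x (rfl | rfl)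
  · refine (hsing f hf).subset ?_
    rintro y ⟨rfl | hy, hne⟩
    · exact absurd rfl hne
    · exact hy
  · refine (hsing e he).subset ?_
    rintro y ⟨hy | hy, hne⟩
    · exact hy
    · exact absurd hy hne

/-- An element outside an independent set `B` that at most two elements of `B` span forms a
dependent triple with two elements of `B`. -/
theorem IsSimple.exists_not_indep_of_mem_closure (hM : M.IsSimple) {B S : Set α} {e : α}
    (hB : M.Indep B) (heB : e ∉ B) (hS : S ⊆ B) (hcard : S.encard ≤ 2) (he : e ∈ M.closure S) :
    ∃ x ∈ B, ∃ y ∈ B, x ≠ y ∧ ¬ M.Indep {x, y, e} := by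
  have heE : e ∈ M.E := M.closure_subset_ground _ he
  have hdep : ¬ M.Indep (insert e S) := by
    have h1 := ((hB.subset hS).mem_closure_iff_of_notMem fun h => heB (hS h)).1 he
    exact h1.not_indep
  rcases hcard.lt_or_eq with h2 | h2
  · exfalso
    have h1 : S.encard ≤ 1 := by
      have : ((1 : ℕ∞) + 1) = 2 := by norm_num
      rw [← this] at h2
      exact Order.le_of_lt_add_one h2
    rcases Set.encard_le_one_iff_eq.1 h1 with rfl | ⟨x, rfl⟩
    · exact hdep ((hM.indep_pair heE heE).subset (by simp))
    · exact hdep (hM.indep_pair heE (hB.subset_ground (hS rfl)))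
  · obtain ⟨x, y, hxy, rfl⟩ := Set.encard_eq_two.1 h2
    refine ⟨x, hS (by simp), y, hS (by simp), hxy, fun h => hdep (h.subset ?_)⟩
    intro z
    simp only [Set.mem_insert_iff, Set.mem_singleton_iff]
    tauto

/-- A frame of `M(K_{r+1})` consists of the edges at one vertex, so the remaining elements are the
third elements `k i j` of the triangles through two frame elements `b i` and `b j`. The count of the
elements shows that each pair of frame elements lies in a triangle. -/
theorem IsFrame.exists_star {r : ℕ} (hM : M.IsSimple) (hfin : M.E.Finite) (hrank : M.eRank = r)
    {X B : Set α} (hXE : X ⊆ M.E)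
    (hX : (M.restrict X).IsIsomorphic (⊤ : SimpleGraph (Fin (r + 1))).cycleMatroid)
    (hBX : B ⊆ X) (hB : (M.restrict X).IsFrame B) :
    X.encard = (r + 1).choose 2 ∧ ∃ (b : Fin r → α) (k : Fin r → Fin r → α),
      Function.Injective b ∧ Set.range b = B ∧ (∀ i j, i ≠ j → k i j ∈ X ∧ k i j ∉ B ∧
        k i j = k j i ∧ ¬ M.Indep {b i, b j, k i j}) ∧
      ∀ i j l, i ≠ j → i ≠ l → j ≠ l → k i j ≠ k i l ∧ k i j ≠ k j l ∧ k i l ≠ k j l ∧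
        ¬ M.Indep {k i j, k i l, k j l} := by
  classical
  obtain ⟨φ, hφ, hind⟩ := hX
  have hXfin : X.Finite := hfin.subset hXE
  have hBfin : B.Finite := hXfin.subset hBX
  have hBind : M.Indep B := (restrict_indep_iff.1 hB.1.indep).1
  change Set.BijOn φ X (⊤ : SimpleGraph (Fin (r + 1))).edgeSet at hφ
  have hXcard : X.ncard = (r + 1).choose 2 := by
    rw [← hφ.injOn.ncard_image, hφ.image_eq, Set.ncard_eq_toFinset_card']
    have := SimpleGraph.card_edgeFinset_top_eq_card_choose_two (V := Fin (r + 1))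
    rw [Fintype.card_fin] at this
    rw [← this, SimpleGraph.edgeFinset]
  have htri : ∀ e ∈ X, ∀ f ∈ X, ∀ g ∈ X, e ≠ f → e ≠ g → f ≠ g →
      (¬ M.Indep {e, f, g} ↔ Sym2.IsTriangle (φ e) (φ f) (φ g)) := by
    intro e he f hf g hg hef heg hfg
    have hsub : ({e, f, g} : Set α) ⊆ X := by simp [Set.insert_subset_iff, he, hf, hg]
    have h1 := hind {e, f, g} hsub
    rw [restrict_indep_iff, and_iff_left hsub, SimpleGraph.cycleMatroid_indep_iff,
      and_iff_right ((Set.image_mono hsub).trans hφ.image_eq.le), Set.image_insert_eq,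
      Set.image_pair] at h1
    rw [h1]
    exact Sym2.not_isAcyclic_fromEdgeSet_iff_isTriangle (hφ.injOn.ne he hf hef)
      (hφ.injOn.ne he hg heg) (hφ.injOn.ne hf hg hfg)
  -- each further element `e` is in a triangle with two frame elements, which form the set `p e`
  have hpair : ∀ e ∈ X \ B, ∃ s : Finset α, ∃ x ∈ B, ∃ y ∈ B, x ≠ y ∧ s = {x, y} ∧
      Sym2.IsTriangle (φ x) (φ y) (φ e) := by
    rintro e ⟨heX, heB⟩
    obtain ⟨S, hSB, hS2, heS⟩ := hB.2 e heX
    rw [restrict_closure_eq _ (hSB.trans hBX)] at heS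
    obtain ⟨x, hx, y, hy, hxy, hdep⟩ :=
      hM.exists_not_indep_of_mem_closure hBind heB hSB hS2 heS.1
    exact ⟨{x, y}, x, hx, y, hy, hxy, rfl, (htri x (hBX hx) y (hBX hy) e heX hxy
      (fun h => heB (h ▸ hx)) (fun h => heB (h ▸ hy))).1 hdep⟩
  choose! p hp using hpair
  set Bf := hBfin.toFinset with hBf
  set Yf := (hXfin.subset (Set.sdiff_subset (s := X) (t := B))).toFinset with hYf
  have hYmem : ∀ e, e ∈ Yf ↔ e ∈ X \ B := fun e => Set.Finite.mem_toFinset _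
  have hmaps : Set.MapsTo p Yf (Bf.powersetCard 2) := by
    intro e he
    obtain ⟨x, hx, y, hy, hxy, hs, -⟩ := hp e ((hYmem e).1 he)
    rw [Finset.mem_coe, Finset.mem_powersetCard, hs, Finset.card_pair hxy]
    simp [Set.insert_subset_iff, hBf, hx, hy]
  have huniq : ∀ e ∈ X, ∀ e' ∈ X, ∀ x y x' y', ({x, y} : Finset α) = {x', y'} → x ≠ y →
      Sym2.IsTriangle (φ x) (φ y) (φ e) → Sym2.IsTriangle (φ x') (φ y') (φ e') → e = e' := by
    intro e he e' he' x y x' y' hs hxy h h'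
    apply hφ.injOn he he'
    have h1 : x = x' ∧ y = y' ∨ x = y' ∧ y = x' := by
      have a1 : x ∈ ({x', y'} : Finset α) := by rw [← hs]; simp
      have a2 : y ∈ ({x', y'} : Finset α) := by rw [← hs]; simp
      simp only [Finset.mem_insert, Finset.mem_singleton] at a1 a2
      rcases a1 with rfl | rfl <;> rcases a2 with rfl | rfl <;> simp_all
    rcases h1 with ⟨rfl, rfl⟩ | ⟨rfl, rfl⟩
    · exact h.unique h'
    · exact h.unique h'.swap
  have hpinj : Set.InjOn p Yf := by
    intro e he e' he' hee
    have heX := (hYmem e).1 he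
    have heX' := (hYmem e').1 he'
    obtain ⟨x, hx, y, hy, hxy, hs, ht⟩ := hp e heX
    obtain ⟨x', hx', y', hy', hxy', hs', ht'⟩ := hp e' heX'
    exact huniq e heX.1 e' heX'.1 x y x' y' (by rw [← hs, ← hs', hee]) hxy ht ht'
  -- `X` has `(r + 1).choose 2` elements, so `B` has `r` elements and `p` attains all their pairs
  have hBle : Bf.card ≤ r := by
    have h1 := hBind.encard_le_eRank
    rw [hrank, hBfin.encard_eq_coe_toFinset_card] at h1
    exact_mod_cast h1
  have hYcard : Yf.card + Bf.card = (r + 1).choose 2 := by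
    rw [← hXcard, ← Set.ncard_sdiff_add_ncard_of_subset hBX hXfin, Set.ncard_eq_toFinset_card _
      (hXfin.subset Set.sdiff_subset), Set.ncard_eq_toFinset_card _ hBfin]
  have hle := Finset.card_le_card_of_injOn p hmaps hpinj
  rw [Finset.card_powersetCard] at hle
  have hBcard : Bf.card = r := by
    by_contra hne
    have hlt : Bf.card + 1 ≤ r := by omega
    have h1 : (Bf.card + 1).choose 2 ≤ r.choose 2 := Nat.choose_le_choose 2 hlt
    have h2 := Nat.choose_succ_succ' Bf.card 1
    have h3 := Nat.choose_succ_succ' r 1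
    simp only [Nat.choose_one_right, Nat.reduceAdd] at h2 h3
    omega
  have hsurj : Set.SurjOn p Yf (Bf.powersetCard 2) := by
    apply Finset.surjOn_of_injOn_of_card_le p hmaps hpinj
    have h3 := Nat.choose_succ_succ' r 1
    simp only [Nat.choose_one_right, Nat.reduceAdd] at h3
    rw [Finset.card_powersetCard, hBcard]
    omega
  let ε := (Bf.equivFinOfCardEq hBcard).symm
  let b : Fin r → α := fun i => (ε i : α)
  have hb : Function.Injective b := Subtype.val_injective.comp ε.injective
  have hbB : ∀ i, b i ∈ B := fun i => hBfin.mem_toFinset.1 (ε i).2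
  have hrange : Set.range b = B := by
    ext e
    refine ⟨?_, fun he => ⟨ε.symm ⟨e, by simpa [hBf] using he⟩, by simp [b]⟩⟩
    rintro ⟨i, rfl⟩
    exact hbB i
  have hk : ∀ i j, ∃ e, i ≠ j → e ∈ X \ B ∧ Sym2.IsTriangle (φ (b i)) (φ (b j)) (φ e) := by
    intro i j
    by_cases hij : i = j
    · exact ⟨b i, fun h => absurd hij h⟩
    obtain ⟨e, he, hpe⟩ := hsurj (show ({b i, b j} : Finset α) ∈ _ by
      rw [Finset.mem_coe, Finset.mem_powersetCard, Finset.card_pair (hb.ne hij)]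
      simp [Set.insert_subset_iff, hBf, hbB])
    have he' := (hYmem e).1 he
    refine ⟨e, fun _ => ⟨he', ?_⟩⟩
    obtain ⟨x, hx, y, hy, hxy, hs, ht⟩ := hp e he'
    rw [hpe] at hs
    have a1 : b i ∈ ({x, y} : Finset α) := by rw [← hs]; simp
    have a2 : b j ∈ ({x, y} : Finset α) := by rw [← hs]; simp
    simp only [Finset.mem_insert, Finset.mem_singleton] at a1 a2
    rcases a1 with a1 | a1 <;> rcases a2 with a2 | a2
    · exact absurd (a1.trans a2.symm) (hb.ne hij)
    · rwa [a1, a2]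
    · rw [a1, a2]
      exact ht.swap
    · exact absurd (a1.trans a2.symm) (hb.ne hij)
  choose k hk using hk
  have hkX := fun i j hij => (hk i j hij).1
  have hkt := fun i j hij => (hk i j hij).2
  refine ⟨by rw [← hXfin.cast_ncard_eq, hXcard], b, k, hb, hrange, fun i j hij =>
    ⟨(hkX i j hij).1, (hkX i j hij).2, ?_, ?_⟩, fun i j l hij hil hjl => ?_⟩
  · exact huniq _ (hkX i j hij).1 _ (hkX j i hij.symm).1 _ _ _ _ (Finset.pair_comm _ _)
      (hb.ne hij) (hkt i j hij) (hkt j i hij.symm)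
  · exact (htri _ (hBX (hbB i)) _ (hBX (hbB j)) _ (hkX i j hij).1 (hb.ne hij)
      (fun h => (hkX i j hij).2 (h ▸ hbB i)) fun h => (hkX i j hij).2 (h ▸ hbB j)).2 (hkt i j hij)
  · have ht : Sym2.IsTriangle (φ (k i j)) (φ (k i l)) (φ (k j l)) := by
      refine (hkt i j hij).of_not_isTriangle (hkt i l hil) (hkt j l hjl) ?_
      rw [← htri _ (hBX (hbB i)) _ (hBX (hbB j)) _ (hBX (hbB l)) (hb.ne hij) (hb.ne hil)
        (hb.ne hjl), not_not]
      exact hBind.subset (by simp [Set.insert_subset_iff, hbB])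
    have hne : k i j ≠ k i l ∧ k i j ≠ k j l ∧ k i l ≠ k j l := by
      obtain ⟨c, u, w, h1, h2, h3, e1, e2, e3⟩ := ht
      refine ⟨fun h => ?_, fun h => ?_, fun h => ?_⟩
      · rw [h, e2, Sym2.eq_iff] at e1
        grind
      · rw [h, e3, Sym2.eq_iff] at e1
        grind
      · rw [h, e3, Sym2.eq_iff] at e2
        grind
    exact ⟨hne.1, hne.2.1, hne.2.2, (htri _ (hkX i j hij).1 _ (hkX i l hil).1 _ (hkX j l hjl).1
      hne.1 hne.2.1 hne.2.2).2 ht⟩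

end Matroid

/-! ### Coordinates with respect to a frame -/

/-- Scaling of a basis `β` such that all `κ i j` become multiples of differences of two basis
vectors. The scaling makes this true for the pairs that contain a fixed index `o`, and the relations
of the triangles through `o` give the other pairs. -/
theorem LinearIndependent.exists_smul_sub_smul {ι V : Type*} [Fintype ι] [DecidableEq ι]
    [Nonempty ι] [AddCommGroup V] [Module ℝ V] {β : ι → V} (hβ : LinearIndependent ℝ β) (κ : ι → ι → V)
    (hsymm : ∀ i j, i ≠ j → κ i j = κ j i)
    (hpair : ∀ i j, i ≠ j → ∃ s t : ℝ, s ≠ 0 ∧ t ≠ 0 ∧ κ i j = s • β i + t • β j)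
    (htri : ∀ i j l, i ≠ j → i ≠ l → j ≠ l → ∃ s t : ℝ, κ j l = s • κ i j + t • κ i l) :
    ∃ c : ι → ℝ, (∀ i, c i ≠ 0) ∧ ∀ i j, i ≠ j → ∃ a : ℝ, a ≠ 0 ∧
      κ i j = a • (c i • β i - c j • β j) := by
  obtain ⟨o⟩ := ‹Nonempty ι›
  have h1 : ∀ j, ∃ s t : ℝ, s ≠ 0 ∧ t ≠ 0 ∧ (o ≠ j → κ o j = s • β o + t • β j) := by
    intro j
    by_cases hj : o = j
    · exact ⟨1, 1, one_ne_zero, one_ne_zero, fun h => absurd hj h⟩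
    · obtain ⟨s, t, hs, ht, h⟩ := hpair o j hj
      exact ⟨s, t, hs, ht, fun _ => h⟩
  choose s t hs ht hst using h1
  obtain ⟨c, hco, hc⟩ : ∃ c : ι → ℝ, c o = 1 ∧ ∀ j, j ≠ o → c j = -(t j / s j) :=
    ⟨fun j => if j = o then 1 else -(t j / s j), if_pos rfl, fun j hj => if_neg hj⟩
  refine ⟨c, fun j => ?_, fun i j hij => ?_⟩
  · by_cases hj : j = o
    · rw [hj, hco]
      exact one_ne_zero
    · rw [hc j hj]
      exact neg_ne_zero.2 (div_ne_zero (ht j) (hs j))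
  have hso : ∀ j, o ≠ j → κ o j = s j • (β o - (-(t j / s j)) • β j) := by
    intro j hj
    rw [hst j hj, smul_sub, smul_smul, sub_eq_add_neg, ← neg_smul]
    congr 2
    field_simp [hs j]
  by_cases hi : i = o
  · subst hi
    exact ⟨s j, hs j, by rw [hso j hij, hco, hc j hij.symm, one_smul]⟩
  by_cases hj : j = o
  · subst hj
    refine ⟨-s i, neg_ne_zero.2 (hs i), ?_⟩
    rw [hsymm i j hij, hso i hij.symm, hco, hc i hij, one_smul]
    module
  obtain ⟨p, q, hp, hq, hpq⟩ := hpair i j hij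
  obtain ⟨S, T, hST⟩ := htri o i j (Ne.symm hi) (Ne.symm hj) hij
  rw [hst i (Ne.symm hi), hst j (Ne.symm hj), hpq] at hST
  have h0 := Fintype.linearIndependent_iff.1 hβ
    (Pi.single o (S * s i + T * s j) + Pi.single i (S * t i - p) + Pi.single j (T * t j - q)) (by
      simp only [Pi.add_apply, add_smul, Finset.sum_add_distrib]
      simp only [Pi.single_apply, ite_smul, zero_smul, Finset.sum_ite_eq', Finset.mem_univ, if_true]
      rw [← sub_eq_zero.2 hST.symm]
      module)
  have e1 := h0 o
  have e2 := h0 i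
  have e3 := h0 j
  simp only [Pi.add_apply, Pi.single_apply, hi, hj, hij, Ne.symm hi, Ne.symm hj, hij.symm, if_true,
    if_false, add_zero, zero_add] at e1 e2 e3
  rw [hc i hi, hc j hj]
  have hp' : p = S * t i := by linarith
  have hq' : q = T * t j := by linarith
  have hSs : -S * s i = T * s j := by linarith
  refine ⟨-S * s i, ?_, ?_⟩
  · refine mul_ne_zero (neg_ne_zero.2 ?_) (hs i)
    rintro rfl
    exact hp (by rw [hp', zero_mul])
  · rw [hpq, smul_sub, smul_smul, smul_smul, sub_eq_add_neg, ← neg_smul]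
    congr 2
    · rw [hp']
      have := hs i
      field_simp
    · rw [hSs, hq']
      have := hs j
      field_simp

/-- In a circuit of size three, each vector is a combination of the other two with nonzero
coefficients. -/
theorem exists_eq_smul_add_smul {α V : Type*} [AddCommGroup V] [Module ℝ V] (v : α → V) {e f g : α}
    (heg : e ≠ g) (hfg : f ≠ g) (h : ¬ LinearIndepOn ℝ v {e, f, g})
    (h₁ : LinearIndepOn ℝ v {e, f}) (h₂ : LinearIndepOn ℝ v {e, g})
    (h₃ : LinearIndepOn ℝ v {f, g}) :
    ∃ s t : ℝ, s ≠ 0 ∧ t ≠ 0 ∧ v g = s • v e + t • v f := by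
  have hset : ({e, f, g} : Set α) = insert g {e, f} := by
    ext x
    simp only [Set.mem_insert_iff, Set.mem_singleton_iff]
    tauto
  rw [hset, linearIndepOn_insert (by simp [heg.symm, hfg.symm]), not_and, not_not,
    Set.image_pair, Submodule.mem_span_pair] at h
  obtain ⟨s, t, hst⟩ := h h₁
  refine ⟨s, t, ?_, ?_, hst.symm⟩
  · rintro rfl
    have := (LinearIndepOn.pair_iff v hfg).1 h₃ t (-1) (by rw [← hst]; simp)
    norm_num at this
  · rintro rfl
    have := (LinearIndepOn.pair_iff v heg).1 h₂ s (-1) (by rw [← hst]; simp)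
    norm_num at this

namespace Matroid

variable {α : Type*} {M : Matroid α}

/-- Suitable multiples of the frame elements, taken as a basis of the space, turn the integer
representation into a framed configuration. -/
theorem IsSimple.exists_framedConfig (hM : M.IsSimple) {r Δ : ℕ} (hr : 0 < r)
    {v : α → Fin r → ℤ}
    (hv : ∀ S ⊆ M.E, M.Indep S ↔ LinearIndepOn ℝ (fun e k => (v e k : ℝ)) S)
    (hdet : ∀ h : Fin r → α, (∀ i, h i ∈ M.E) → |(Matrix.of fun i => v (h i)).det| ≤ Δ)
    {X B : Set α} (hXE : X ⊆ M.E) (hBX : B ⊆ X) (hB : M.Indep B)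
    {b : Fin r → α} {k : Fin r → Fin r → α}
    (hb : Function.Injective b) (hbB : Set.range b = B)
    (hk : ∀ i j, i ≠ j → k i j ∈ X ∧ k i j ∉ B ∧ k i j = k j i ∧ ¬ M.Indep {b i, b j, k i j})
    (hkk : ∀ i j l, i ≠ j → i ≠ l → j ≠ l → k i j ≠ k i l ∧ k i j ≠ k j l ∧ k i l ≠ k j l ∧
        ¬ M.Indep {k i j, k i l, k j l}) :
    ∃ (F : FramedConfig (Fin r) α Δ) (γ : Fin r → ℝ), F.E = M.E ∧ F.b = b ∧ F.k = k ∧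
      (Matrix.of fun i => v (b i)).det ≠ 0 ∧
      (∀ S ⊆ M.E, M.Indep S ↔ LinearIndepOn ℝ F.x S) ∧
      ∀ e l, (v e l : ℝ) = ∑ i, F.x e i * γ i * v (b i) l := by
  classical
  have : Nonempty (Fin r) := ⟨⟨0, hr⟩⟩
  set V : α → Fin r → ℝ := fun e l => (v e l : ℝ) with hV
  have hbX : ∀ i, b i ∈ X := fun i => hBX (hbB ▸ Set.mem_range_self i)
  have hbE : ∀ i, b i ∈ M.E := fun i => hXE (hbX i)
  have hβ : LinearIndependent ℝ (fun i => V (b i)) := by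
    rw [← hbB] at hB
    exact (linearIndepOn_range_iff hb V).1 ((hv _ (by rintro _ ⟨i, rfl⟩; exact hbE i)).1 hB)
  have htriple : ∀ e ∈ X, ∀ f ∈ X, ∀ g ∈ X, e ≠ g → f ≠ g → ¬ M.Indep {e, f, g} →
      ∃ s t : ℝ, s ≠ 0 ∧ t ≠ 0 ∧ V g = s • V e + t • V f := by
    intro e he f hf g hg heg hfg hdep
    have h2 : ∀ x ∈ X, ∀ y ∈ X, LinearIndepOn ℝ V {x, y} := fun x hx y hy =>
      (hv _ (by simp [Set.insert_subset_iff, hXE hx, hXE hy])).1 (hM.indep_pair (hXE hx) (hXE hy))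
    refine exists_eq_smul_add_smul V heg hfg ?_ (h2 e he f hf) (h2 e he g hg) (h2 f hf g hg)
    rwa [← hv _ (by simp [Set.insert_subset_iff, hXE he, hXE hf, hXE hg])]
  obtain ⟨c, hc, hck⟩ := hβ.exists_smul_sub_smul (fun i j => V (k i j))
    (fun i j hij => by rw [(hk i j hij).2.2.1])
    (fun i j hij => by
      obtain ⟨h1, h2, -, h3⟩ := hk i j hij
      exact htriple _ (hbX i) _ (hbX j) _ h1 (fun h => h2 (h ▸ hbB ▸ Set.mem_range_self i))
        (fun h => h2 (h ▸ hbB ▸ Set.mem_range_self j)) h3)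
    (fun i j l hij hil hjl => by
      obtain ⟨-, h2, h3, h4⟩ := hkk i j l hij hil hjl
      obtain ⟨s, t, -, -, h⟩ := htriple _ (hk i j hij).1 _ (hk i l hil).1 _ (hk j l hjl).1 h2 h3 h4
      exact ⟨s, t, h⟩)
  set W : Matrix (Fin r) (Fin r) ℝ := Matrix.of fun i => c i • V (b i) with hW
  have hWdet : W.det ≠ 0 := by
    have h1 : LinearIndependent ℝ W.row :=
      hβ.units_smul fun i => Units.mk0 (c i) (hc i)
    exact (Matrix.isUnit_iff_isUnit_det _).1 (Matrix.linearIndependent_rows_iff_isUnit.1 h1)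
      |>.ne_zero
  have hWu : IsUnit W.det := isUnit_iff_ne_zero.2 hWdet
  set x : α → Fin r → ℝ := fun e => Matrix.vecMul (V e) W⁻¹ with hx
  have hxW : ∀ e, Matrix.vecMul (x e) W = V e := by
    intro e
    rw [hx, Matrix.vecMul_vecMul, Matrix.nonsing_inv_mul _ hWu, Matrix.vecMul_one]
  have hinj : Function.Injective W.vecMulLinear :=
    Matrix.vecMul_injective_of_isUnit ((Matrix.isUnit_iff_isUnit_det _).2 hWu)
  choose! a ha hka using hck
  refine ⟨{ E := M.E, x := x, d := W.det, d_ne := hWdet, exists_int := ?_, b := b, b_mem := hbE,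
            β := fun i => (c i)⁻¹, β_ne := fun i => inv_ne_zero (hc i), x_b := ?_, k := k,
            k_mem := fun i j hij => hXE (hk i j hij).1, a := a, a_ne := ha, x_k := ?_ },
    c, rfl, rfl, rfl, ?_, fun S hS => ?_, fun e l => ?_⟩
  · intro h hh
    refine ⟨(Matrix.of fun i => v (h i)).det, hdet h hh, ?_⟩
    have h1 : (Matrix.of fun i => x (h i)) * W =
        (Matrix.of fun i => v (h i)).map (Int.castRingHom ℝ) := by
      ext i j
      rw [Matrix.mul_apply_eq_vecMul]
      exact congrFun (hxW (h i)) j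
    rw [mul_comm, ← Matrix.det_mul, h1, ← RingHom.mapMatrix_apply, ← RingHom.map_det]
    rfl
  · intro i
    apply hinj
    change Matrix.vecMul (x (b i)) W = Matrix.vecMul _ W
    rw [hxW, Matrix.single_vecMul]
    change _ = (c i)⁻¹ • (c i • V (b i))
    rw [smul_smul, inv_mul_cancel₀ (hc i), one_smul]
  · intro i j hij
    apply hinj
    change Matrix.vecMul (x (k i j)) W = Matrix.vecMul _ W
    rw [hxW, Matrix.sub_vecMul, Matrix.single_vecMul, Matrix.single_vecMul]
    change _ = a i j • (c i • V (b i)) - a i j • (c j • V (b j))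
    rw [hka i j hij, smul_sub]
  · have h1 := (Matrix.isUnit_iff_isUnit_det _).1 (Matrix.linearIndependent_rows_iff_isUnit.1
      (show LinearIndependent ℝ ((Matrix.of fun i => v (b i)).map (Int.castRingHom ℝ)).row from hβ))
    rw [← RingHom.mapMatrix_apply, ← RingHom.map_det] at h1
    exact fun h => h1.ne_zero (by rw [h, map_zero])
  · have h1 := LinearMap.linearIndepOn_iff_of_injOn W.vecMulLinear (v := x) (s := S) hinj.injOn
    have h2 : W.vecMulLinear ∘ x = V := funext hxW
    rw [h2] at h1
    exact (hv S hS).trans h1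
  · have h1 := congrFun (hxW e) l
    change ∑ i, x e i * (c i * v (b i) l) = (v e l : ℝ) at h1
    rw [← h1]
    simp only [mul_assoc]

end Matroid

/-! ### From coordinates to contractions -/

namespace Matroid

variable {α : Type*} {M : Matroid α}

/-- An element is spanned by the frame elements in its support. -/
theorem mem_closure_image_of_support_subset {ι : Type*} [Fintype ι] [DecidableEq ι] {Δ : ℕ}
    (F : FramedConfig ι α Δ) (hF : ∀ S ⊆ M.E, M.Indep S ↔ LinearIndepOn ℝ F.x S)
    (hB : M.Indep (Set.range F.b)) {e : α} (he : e ∈ M.E) {S : Set ι}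
    (hS : ∀ i ∉ S, F.x e i = 0) : e ∈ M.closure (F.b '' S) := by
  by_contra hcl
  obtain ⟨h1, h2⟩ := ((hB.subset (Set.image_subset_range _ S)).notMem_closure_iff he).1 hcl
  rw [hF _ h1.subset_ground, linearIndepOn_insert h2] at h1
  refine h1.2 ?_
  have hsum : F.x e = ∑ i, (F.x e i / F.β i) • F.x (F.b i) := by
    ext l
    simp [F.x_b, Pi.single_apply, F.β_ne]
  rw [hsum]
  refine Submodule.sum_mem _ fun i _ => ?_
  by_cases hi : i ∈ S
  · exact Submodule.smul_mem _ _ (Submodule.subset_span ⟨_, ⟨i, hi, rfl⟩, rfl⟩)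
  · simp [hS i hi]

theorem IsSimple.eq_of_eq_smul {V : Type*} [AddCommGroup V] [Module ℝ V]
    (hM : M.IsSimple) {v : α → V} (hv : ∀ S ⊆ M.E, M.Indep S ↔ LinearIndepOn ℝ v S) {e f : α}
    (he : e ∈ M.E) (hf : f ∈ M.E) (t : ℝ) (h : v e = t • v f) : e = f := by
  by_contra hef
  have h1 := (hv _ (by simp [Set.insert_subset_iff, he, hf])).1 (hM.indep_pair he hf)
  have h2 := (LinearIndepOn.pair_iff v hef).1 h1 1 (-t) (by rw [h]; simp)
  exact one_ne_zero h2.1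

end Matroid

/-- `(⊤ : SimpleGraph (Fin (r + 1))).cycleMatroid` is `M(K_{r+1})`, and `Nat.log 2 Δ = ⌊log₂ Δ⌋`. -/
theorem proposition3p1 {α : Type*} (r Δ : ℕ) (hr : 0 < r) (hΔ : 0 < Δ)
    (M : Matroid α) (hM : M.IsDeltaModular Δ) (hsimple : M.IsSimple) (hrank : M.eRank = r)
    (X : Set α) (hXE : X ⊆ M.E)
    (hX : (M.restrict X).IsIsomorphic (⊤ : SimpleGraph (Fin (r + 1))).cycleMatroid)
    (B : Set α) (hBX : B ⊆ X) (hB : (M.restrict X).IsFrame B) :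
    (∃ B' ⊆ B, B'.encard ≤ ((10 * Δ ^ 2 * Nat.log 2 Δ : ℕ) : ℕ∞) ∧
      ∀ e ∈ M.E \ X, (M.contract B').IsNonloop e →
        ∃ b ∈ B \ B', (M.contract B').IsParallel e b) ∧
    M.E.encard ≤ (((r + 1).choose 2 + 66 * Δ ^ 7 * r : ℕ) : ℕ∞) := by
  classical
  obtain ⟨hfin, v, hv, hdet⟩ := hM.exists_int_vectors hrank
  obtain ⟨hXcard, b, k, hb, hbB, hk, hkk⟩ :=
    Matroid.IsFrame.exists_star hsimple hfin hrank hXE hX hBX hB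
  have hBind : M.Indep B := (Matroid.restrict_indep_iff.1 hB.1.indep).1
  obtain ⟨F, γ, hFE, rfl, rfl, hdet0, hFx, hFγ⟩ :=
    hsimple.exists_framedConfig hr hv hdet hXE hBX hBind hb hbB hk hkk
  subst hbB
  obtain ⟨C, hCcard, hC1, hC⟩ := F.exists_contraction_set
  have hbX : ∀ i, F.b i ∈ X := fun i => hBX ⟨i, rfl⟩
  -- Two nonzero coordinates with sum `0` would make `e` parallel to an element of `X`.
  have hsupp : ∀ e ∈ M.E \ X, ∀ i ∉ C, ∀ j ∉ C, F.x e i ≠ 0 → F.x e j ≠ 0 → i = j := by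
    rintro e ⟨heE, heX⟩
    rcases hC e (hFE ▸ heE) with ⟨i, j, hij, hneg, h0⟩ | h
    · exfalso
      have h1 := hsimple.eq_of_eq_smul hFx heE (hXE (hk i j hij).1)
        (F.x e i / F.a i j) (by
          rw [F.x_k i j hij]
          have ha := F.a_ne i j hij
          ext l
          by_cases hli : l = i
          · subst hli
            simp [hij, ha]
          · by_cases hlj : l = j
            · subst hlj
              simp [hij.symm, ha, hneg]
            · simp [hli, hlj, h0 l hli hlj])
      exact heX (h1 ▸ (hk i j hij).1)
    · exact h
  constructor
  · -- an element that is no loop has exactly one nonzero coordinate outside of `C`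
    have hC'ind : M.Indep (F.b '' C) := hBind.subset (Set.image_subset_range _ _)
    refine ⟨F.b '' C, Set.image_subset_range _ _, ?_, ?_⟩
    · rw [hb.encard_image, Set.encard_coe_eq_coe_finsetCard]
      norm_cast
      rcases (Nat.succ_le_of_lt hΔ).lt_or_eq with h | h
      · have hlog : 1 ≤ Nat.log 2 Δ := Nat.log_pos (by norm_num) h
        calc C.card ≤ 6 * Δ := hCcard
          _ ≤ 10 * Δ ^ 2 * 1 := by nlinarith
          _ ≤ 10 * Δ ^ 2 * Nat.log 2 Δ := Nat.mul_le_mul_left _ hlog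
      · -- the bound is zero for `Δ = 1`
        simp [hC1 h.symm]
    · intro e he hnl
      rw [Matroid.contract_isNonloop_iff] at hnl
      obtain ⟨i, hiC, hi⟩ : ∃ i ∉ C, F.x e i ≠ 0 := by
        by_contra! hcon
        exact hnl.2 (Matroid.mem_closure_image_of_support_subset F hFx hBind he.1 hcon)
      have hbi : F.b i ∉ F.b '' C := by
        rintro ⟨j, hj, hji⟩
        exact hiC (hb hji ▸ hj)
      have heb : e ≠ F.b i := fun h => he.2 (h ▸ hbX i)
      have heC : e ∉ F.b '' C := fun ⟨j, _, hj⟩ => he.2 (hj ▸ hbX j)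
      refine ⟨F.b i, ⟨⟨i, rfl⟩, hbi⟩, heb, ?_⟩
      rw [Matroid.isCircuit_iff_dep_forall_sdiff_singleton_indep]
      refine ⟨⟨fun hind => ?_, ?_⟩, ?_⟩
      · rw [hC'ind.contract_indep_iff] at hind
        have hcl : e ∈ M.closure (F.b '' (insert i (C : Set (Fin r)))) := by
          refine Matroid.mem_closure_image_of_support_subset F hFx hBind he.1 fun l hl => ?_
          by_contra h0
          rw [Set.mem_insert_iff, not_or] at hl
          exact hl.1 (hsupp e he l hl.2 i hiC h0 hi)
        refine ((hBind.subset (Set.image_subset_range _ _)).notMem_closure_iff he.1).2 ⟨?_, ?_⟩ hcl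
        · refine hind.2.subset ?_
          rw [Set.image_insert_eq]
          simp [Set.insert_subset_iff]
        · rintro ⟨j, _, hj⟩
          exact he.2 (hj ▸ hbX j)
      · simp only [Matroid.contract_ground, Set.insert_subset_iff, Set.singleton_subset_iff]
        exact ⟨⟨he.1, heC⟩, hXE (hbX i), hbi⟩
      · have hebC : (M.contract (F.b '' C)).Indep {F.b i} := by
          rw [hC'ind.contract_indep_iff]
          refine ⟨Set.disjoint_singleton_left.2 hbi, hBind.subset ?_⟩
          exact Set.union_subset (by simp) (Set.image_subset_range _ _)
        have heC' : (M.contract (F.b '' C)).Indep {e} :=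
          Matroid.indep_singleton.2 (Matroid.contract_isNonloop_iff.2 hnl)
        rintro y (rfl | rfl)
        · refine hebC.subset ?_
          rintro z ⟨rfl | hz, hne⟩
          · exact absurd rfl hne
          · exact hz
        · refine heC'.subset ?_
          rintro z ⟨hz | hz, hne⟩
          · exact hz
          · exact absurd hz hne
  · have : Nonempty (Fin r) := ⟨⟨0, hr⟩⟩
    set Y := (hfin.subset (Set.sdiff_subset (s := M.E) (t := X))).toFinset with hY
    have hYmem : ∀ e, e ∈ Y ↔ e ∈ M.E \ X := fun e => Set.Finite.mem_toFinset _
    -- the elements outside of `X` in the span of the contracted set and one further frame element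
    let T : Fin r → Finset α := fun i => Y.filter fun e => ∀ l ∉ insert i C, F.x e l = 0
    have hcover : Y ⊆ Finset.univ.biUnion T := by
      intro e he
      simp only [T, Finset.mem_biUnion, Finset.mem_univ, true_and, Finset.mem_filter, he,
        Finset.mem_insert, not_or]
      by_cases h : ∃ i ∉ C, F.x e i ≠ 0
      · obtain ⟨i, hiC, hi⟩ := h
        refine ⟨i, fun l hl => ?_⟩
        by_contra h0
        exact hl.1 (hsupp e ((hYmem e).1 he) l hl.2 i hiC h0 hi)
      · push Not at h
        exact ⟨Classical.arbitrary _, fun l hl => h l hl.2⟩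
    have hT : ∀ i, (T i).card ≤ 66 * Δ ^ 6 * Δ := by
      intro i
      have hTE : ∀ e ∈ T i, e ∈ M.E := fun e he =>
        ((hYmem e).1 (Finset.mem_filter.1 he).1).1
      have hS : (insert i C).card ≤ C.card + 1 := Finset.card_insert_le _ _
      refine card_le_of_abs_det_le v M.E Δ _ hdet F.b (fun i => hXE (hbX i)) hdet0 (insert i C)
        (T i) hTE (fun e he => ⟨fun l => F.x e l * γ l, fun l hl => ?_, hFγ e⟩)
        (fun e he f hf h => ?_)
        (sum_choose_mul_sum_choose_le hΔ (by omega) fun h => by rw [hC1 h]; simp)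
      · dsimp only
        rw [(Finset.mem_filter.1 he).2 l hl, zero_mul]
      · rcases h with h | h
        · exact hsimple.eq_of_eq_smul hv (hTE e he) (hTE f hf) 1 (by simp [h])
        · refine hsimple.eq_of_eq_smul hv (hTE e he) (hTE f hf) (-1) ?_
          ext l
          simp [h]
    have hYcard : Y.card ≤ 66 * Δ ^ 7 * r := by
      refine (Finset.card_le_card hcover).trans ((Finset.card_biUnion_le_card_mul _ _ _
        fun i _ => hT i).trans (le_of_eq ?_))
      rw [Finset.card_univ, Fintype.card_fin]
      ring
    rw [← Set.encard_sdiff_add_encard_of_subset hXE, hXcard,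
      (hfin.subset Set.sdiff_subset).encard_eq_coe_toFinset_card, ← hY, add_comm]
    exact_mod_cast Nat.add_le_add_left hYcard _
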